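/- **Setting.** Let $d\in\{2,3\}$ and let $\Omega\subset\mathbb R^d$ be a bounded open set. Write $\|\cdot\|$, $(\cdot,\cdot)$ for the norm and inner product of $L^2(\Omega)$ (scalar, vector or matrix valued, with the Frobenius norm on matrices), $X=[H^1_0(\Omega)]^d$ (the $H^1$-closure of $C_c^\infty(\Omega;\mathbb R^d)$), $Q=L^2_0(\Omega)$ (mean-zero functions), $\|g\|_{-1}=\sup_{0\ne v\in X}(g,v)/\|\nabla v\|$, and $b^*(w,u,v)=\tfrac12(w\cdot\nabla u,v)-\tfrac12(w\cdot\nabla v,u)$. *Exact solution.* For $\nu,T>0$ let $u:[0,T]\to X$, $p:[0,T]\to Q$ be a weak solution of the Navier–Stokes equations, i.e. for almost all $t\in(0,T]$ $$(u_t,v)+(u\cdot\nabla u,v)+\nu(\nabla u,\nabla v)-(p,\nabla\cdot v)=(f,v)\ \ \forall v\in X,\qquad (\nabla\cdot u,q)=0\ \ \forall q\in Q,\qquad u(0)=u^0\in X,$$ where $f\in C([0,T];L^2)$, $u\in H^1(0,T;X)\cap H^2(0,T;L^2)$, $p\in W^{1,\infty}(0,T;L^2)$ ($u$ and $p$ being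 the representatives continuous in time). *POD spaces.* Let $\{\varphi_i\}_{i=1}^R\subset X$ and $\{\psi_i\}_{i=1}^M\subset Q$ be POD bases of finitely many velocity snapshots in $X$ and pressure snapshots in $Q$: they are $L^2$-orthonormal and minimize $\sum_n\|u_S^n-\sum_j(u_S^n,\varphi_j)\varphi_j\|^2$, respectively $\sum_n\|p_S^n-\sum_j(p_S^n,\psi_j)\psi_j\|^2$, among $L^2$-orthonormal families of the same length in $X$, respectively $Q$. Let $X_R=\mathrm{span}\{\varphi_i\}$, $Q_M=\mathrm{span}\{\psi_i\}$, let $P_R$, $\chi_M$ be the $L^2$ projections onto $X_R$, $Q_M$, and let $\alpha=\cos\theta_1$, where $$\theta_1=\min\Big\{\arccos\frac{|(v,\psi)|}{\|v\|\|\psi\|}: v\in\mathrm{span}\{\nabla\cdot\varphi_i\},\ \psi\in Q_M\Big\}\in[0,\tfrac\pi2]$$ is the first principal angle (pairs with a zero vector count as $\pi/2$). *AC-ROM.* Let $N\ge1$, $\Delta t=T/N$, $t_n=n\Delta t$, $g^n=g(t_n)$ for a function $g$ of time, and $\varepsilon>0$. Let $u_R^n\in X_R$, $p_M^n\in Q_M$,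 $0\le n\le N$, satisfy for $0\le n\le N-1$ $$\Big(\tfrac{u_R^{n+1}-u_R^n}{\Delta t},\varphi\Big)+b^*(u_R^n,u_R^{n+1},\varphi)+\nu(\nabla u_R^{n+1},\nabla\varphi)-(p_M^{n+1},\nabla\cdot\varphi)=(f^{n+1},\varphi)\ \ \forall\varphi\in X_R,$$ $$\varepsilon\Big(\tfrac{p_M^{n+1}-p_M^n}{\Delta t},\psi\Big)+(\nabla\cdot u_R^{n+1},\psi)=0\ \ \forall\psi\in Q_M .$$ *Errors.* Put $e_u^n=u^n-u_R^n$, $\eta^n=u^n-P_Ru^n$, $\xi_R^n=u_R^n-P_Ru^n$, $e_p^n=p^n-p_M^n$, $\kappa^n=p^n-\chi_Mp^n$, $\pi_M^n=p_M^n-\chi_Mp^n$, $|||v|||_{2,0}^2=\Delta t\sum_{n=0}^N\|v^n\|^2$, and $$\mathcal E(a,b)=\|a^N\|^2+\varepsilon\|b^N\|^2+\tfrac{\nu\Delta t}2\|\nabla a^N\|^2+\tfrac\nu2|||\nabla a|||_{2,0}^2+\sum_{n=0}^{N-1}\Big(\|a^{n+1}-a^n\|^2+\tfrac\varepsilon2\|b^{n+1}-b^n\|^2\Big).$$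 **Theorem 5.1.** For all $\nu_0>0$, $c_1>0$, $c_2$ and $K$ there are constants $C,\widetilde C>0$, depending only on these numbers and on $\Omega$ and $d$, with the following property. Suppose in the above setting that $\nu\le\nu_0$, that $\varepsilon$ is of the order of $\Delta t$ in the sense $c_1\Delta t\le\varepsilon\le c_2\Delta t$, that $\sup_{[0,T]}\|\nabla u\|\le K$, and that $$\|u_R^0\|^2+\nu\Delta t\|\nabla u_R^0\|^2+\varepsilon\|p_M^0\|^2+\frac{4\Delta t}{\nu}\sum_{n=0}^{N-1}\|f^{n+1}\|_{-1}^2\le K .$$ Then $$\begin{aligned}\mathcal E(e_u,e_p)\le{}&\mathcal E(\eta,\kappa)+C\exp\Big(\frac{\widetilde CT}{\nu^3}\Big)\bigg(\|\xi_R^0\|^2+\varepsilon\|\pi_M^0\|^2+\Delta t\,\nu\|\nabla\xi_R^0\|^2\\&+\Big(\frac1\nu+\alpha^2\Delta t^{-1}\Big)|||\nabla\eta|||_{2,0}^2+\frac1\nu|||\kappa|||_{2,0}^2+\frac{\Delta t^2}\nu\|u_{tt}\|_{L^2(0,T;L^2)}^2+\frac{\Delta t^2}\nu\|\nabla u_t\|_{L^2(0,T;L^2)}^2\\&+\frac{\Delta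 t^{1/2}}{\nu^{3/2}}\Big(\sum_{n=0}^{N-1}\|\nabla\eta^{n+1}\|^4\Big)^{1/2}+\Delta t^3\|p_t\|_{L^2(0,T;L^2)}^2+\Delta t\,\|p_t\|_{L^\infty(0,T;L^2)}^2\bigg).\end{aligned}$$ -/

import Mathlib

open MeasureTheory Set
open scoped ContDiff

noncomputable section

namespace ACROM

variable {d : ℕ}

/-- The physical space `ℝ^d` with its Euclidean norm. -/
abbrev Pt (d : ℕ) : Type := EuclideanSpace ℝ (Fin d)

/-- `d × d` matrices with the Frobenius norm; the entry `(i, j)` of a gradient is `∂_j v_i`. -/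
abbrev Mat (d : ℕ) : Type := EuclideanSpace ℝ (Fin d × Fin d)

/-- `L²(Ω)`. -/
abbrev L2S (Ω : Set (Pt d)) : Type := Lp ℝ 2 (volume.restrict Ω)

/-- `[L²(Ω)]^d`. -/
abbrev L2V (Ω : Set (Pt d)) : Type := Lp (Pt d) 2 (volume.restrict Ω)

/-- `[L²(Ω)]^{d×d}`. -/
abbrev L2M (Ω : Set (Pt d)) : Type := Lp (Mat d) 2 (volume.restrict Ω)

/-- The classical Jacobian matrix `(∂_j φ_i)_{i,j}` of a vector field. -/
def jacobian (φ : Pt d → Pt d) (x : Pt d) : Mat d :=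
  WithLp.toLp 2 fun ij => fderiv ℝ φ x (EuclideanSpace.single ij.2 1) ij.1

/-- The pairs `(φ, ∇φ)` with `φ ∈ C_c^∞(Ω; ℝ^d)`. -/
def testPairs (Ω : Set (Pt d)) : Set (L2V Ω × L2M Ω) :=
  {z | ∃ φ : Pt d → Pt d, ContDiff ℝ ∞ φ ∧ HasCompactSupport φ ∧ tsupport φ ⊆ Ω ∧
    z.1 =ᵐ[volume.restrict Ω] φ ∧ z.2 =ᵐ[volume.restrict Ω] jacobian φ}

/-- `X = [H¹₀(Ω)]^d`, the closure of `C_c^∞(Ω; ℝ^d)` in `H¹`. A member `v` is stored together with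
its weak gradient as the pair `(v, ∇v)`; the product norm is equivalent to the `H¹` norm. -/
def X (Ω : Set (Pt d)) : Submodule ℝ (L2V Ω × L2M Ω) :=
  (Submodule.span ℝ (testPairs Ω)).topologicalClosure

/-- `X` is complete, so that Bochner integrals of `X`-valued functions are meaningful. -/
instance (Ω : Set (Pt d)) : CompleteSpace (X Ω) :=
  (Submodule.isClosed_topologicalClosure _).completeSpace_coe

/-- The embedding `X ⊂ [L²(Ω)]^d`. -/
def vel {Ω : Set (Pt d)} : X Ω →L[ℝ] L2V Ω :=
  (ContinuousLinearMap.fst ℝ (L2V Ω) (L2M Ω)).comp (X Ω).subtypeL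

/-- The weak gradient. -/
def grad {Ω : Set (Pt d)} : X Ω →L[ℝ] L2M Ω :=
  (ContinuousLinearMap.snd ℝ (L2V Ω) (L2M Ω)).comp (X Ω).subtypeL

/-- The trace of a matrix. -/
def matTrace : Mat d →L[ℝ] ℝ := ∑ i : Fin d, EuclideanSpace.proj (i, i)

/-- The weak divergence, the trace of the weak gradient. -/
def divg {Ω : Set (Pt d)} : X Ω →L[ℝ] L2S Ω :=
  ((matTrace (d := d)).compLpL 2 (volume.restrict Ω)).comp grad

/-- Membership in `Q = L²₀(Ω)`: the mean value vanishes. -/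
def MeanZero {Ω : Set (Pt d)} (q : L2S Ω) : Prop := ∫ x in Ω, q x = 0

/-- `b(w, u, v) = (w · ∇u, v)`. -/
def convForm {Ω : Set (Pt d)} (w u v : X Ω) : ℝ :=
  ∫ x in Ω, ∑ i : Fin d, ∑ j : Fin d, vel w x j * grad u x (i, j) * vel v x i

/-- `b*(w, u, v) = ½ (w · ∇u, v) - ½ (w · ∇v, u)`. -/
def skewForm {Ω : Set (Pt d)} (w u v : X Ω) : ℝ :=
  1 / 2 * convForm w u v - 1 / 2 * convForm w v u

/-- `‖g‖₋₁ = sup_{0 ≠ v ∈ X} (g, v) / ‖∇v‖` (the value at `v = 0` is `0 / 0 = 0`). -/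
def negNorm {Ω : Set (Pt d)} (g : L2V Ω) : ℝ :=
  ⨆ v : X Ω, inner ℝ g (vel v) / ‖grad v‖

/-- `(u, p)` is a weak solution of the Navier–Stokes equations on `(0, T]` with viscosity `ν`,
force `f` and initial velocity `u₀`; `ut` is the time derivative of `u`. -/
structure IsWeakNSE (Ω : Set (Pt d)) (ν T : ℝ) (f : ℝ → L2V Ω) (u₀ : X Ω)
    (u ut : ℝ → X Ω) (p : ℝ → L2S Ω) : Prop where
  momentum : ∀ᵐ t ∂(volume.restrict (Ioc 0 T)), ∀ v : X Ω,
    inner ℝ (vel (ut t)) (vel v) + convForm (u t) (u t) v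
      + ν * inner ℝ (grad (u t)) (grad v) - inner ℝ (p t) (divg v) = inner ℝ (f t) (vel v)
  continuity : ∀ᵐ t ∂(volume.restrict (Ioc 0 T)), ∀ q : L2S Ω, MeanZero q →
    inner ℝ (divg (u t)) q = 0
  initial : u 0 = u₀
  pressure_mean : ∀ t ∈ Icc 0 T, MeanZero (p t)

/-- Regularity in time: `f ∈ C([0,T]; L²)`, `u ∈ H¹(0,T; X) ∩ H²(0,T; L²)`,
`p ∈ W^{1,∞}(0,T; L²)`, with `u`, `p` the representatives that are continuous in time and with
(Bochner) time derivatives `ut`, `utt`, `pt`. -/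
structure IsTimeRegular (Ω : Set (Pt d)) (T : ℝ) (f : ℝ → L2V Ω) (u ut : ℝ → X Ω)
    (utt : ℝ → L2V Ω) (p pt : ℝ → L2S Ω) : Prop where
  f_cont : ContinuousOn f (Icc 0 T)
  ut_mem : MemLp ut 2 (volume.restrict (Ioc 0 T))
  u_eq : ∀ t ∈ Icc 0 T, u t = u 0 + ∫ s in (0 : ℝ)..t, ut s
  utt_mem : MemLp utt 2 (volume.restrict (Ioc 0 T))
  ut_eq : ∃ a : L2V Ω, ∀ᵐ t ∂(volume.restrict (Ioc 0 T)),
    vel (ut t) = a + ∫ s in (0 : ℝ)..t, utt s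
  pt_mem : MemLp pt ⊤ (volume.restrict (Ioc 0 T))
  p_eq : ∀ t ∈ Icc 0 T, p t = p 0 + ∫ s in (0 : ℝ)..t, pt s

/-- `φ` is a velocity POD basis of the snapshots `s`: it is `L²`-orthonormal and minimizes
`∑_n ‖s_n - ∑_j (s_n, φ_j) φ_j‖²` among the `L²`-orthonormal families of the same length in `X`. -/
def IsVelPOD {Ω : Set (Pt d)} {k R : ℕ} (s : Fin k → X Ω) (φ : Fin R → X Ω) : Prop :=
  Orthonormal ℝ (fun j => vel (φ j)) ∧
  ∀ χ : Fin R → X Ω, Orthonormal ℝ (fun j => vel (χ j)) →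
    ∑ n, ‖vel (s n) - ∑ j, inner ℝ (vel (s n)) (vel (φ j)) • vel (φ j)‖ ^ 2
      ≤ ∑ n, ‖vel (s n) - ∑ j, inner ℝ (vel (s n)) (vel (χ j)) • vel (χ j)‖ ^ 2

/-- `ψ` is a pressure POD basis of the snapshots `s`, within `Q = L²₀(Ω)`. -/
def IsPresPOD {Ω : Set (Pt d)} {k M : ℕ} (s : Fin k → L2S Ω) (ψ : Fin M → L2S Ω) : Prop :=
  Orthonormal ℝ ψ ∧ (∀ j, MeanZero (ψ j)) ∧
  ∀ χ : Fin M → L2S Ω, Orthonormal ℝ χ → (∀ j, MeanZero (χ j)) →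
    ∑ n, ‖s n - ∑ j, inner ℝ (s n) (ψ j) • ψ j‖ ^ 2
      ≤ ∑ n, ‖s n - ∑ j, inner ℝ (s n) (χ j) • χ j‖ ^ 2

/-- The `L²` projection of `v` onto `X_R = span {φ_i}`, for `L²`-orthonormal `φ`. -/
def velProj {Ω : Set (Pt d)} {R : ℕ} (φ : Fin R → X Ω) (v : X Ω) : X Ω :=
  ∑ i, inner ℝ (vel v) (vel (φ i)) • φ i

/-- The `L²` projection of `q` onto `Q_M = span {ψ_i}`, for orthonormal `ψ`. -/
def presProj {Ω : Set (Pt d)} {M : ℕ} (ψ : Fin M → L2S Ω) (q : L2S Ω) : L2S Ω :=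
  ∑ i, inner ℝ q (ψ i) • ψ i

theorem velProj_orthogonal {Ω : Set (Pt d)} {R : ℕ} {φ : Fin R → X Ω}
    (hφ : Orthonormal ℝ (fun j => vel (φ j))) (v w : X Ω)
    (hw : w ∈ Submodule.span ℝ (range φ)) : inner ℝ (vel (v - velProj φ v)) (vel w) = 0 := by
  induction hw using Submodule.span_induction with
  | mem x hx =>
    obtain ⟨k, rfl⟩ := hx
    have h : ∀ i, inner ℝ (vel (φ i)) (vel (φ k)) = if i = k then (1 : ℝ) else 0 :=
      orthonormal_iff_ite.mp hφ |> fun h i => h i k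
    simp [velProj, inner_sub_left, sum_inner, inner_smul_left, h]
  | zero => simp
  | add x y _ _ hx hy => rw [map_add, inner_add_right, hx, hy, add_zero]
  | smul a x _ hx => rw [map_smul, inner_smul_right, hx, mul_zero]

theorem presProj_orthogonal {Ω : Set (Pt d)} {M : ℕ} {ψ : Fin M → L2S Ω}
    (hψ : Orthonormal ℝ ψ) (q r : L2S Ω)
    (hr : r ∈ Submodule.span ℝ (range ψ)) : inner ℝ (q - presProj ψ q) r = 0 := by
  induction hr using Submodule.span_induction with
  | mem x hx =>
    obtain ⟨k, rfl⟩ := hx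
    have h : ∀ i, inner ℝ (ψ i) (ψ k) = if i = k then (1 : ℝ) else 0 :=
      orthonormal_iff_ite.mp hψ |> fun h i => h i k
    simp [presProj, inner_sub_left, sum_inner, inner_smul_left, h]
  | zero => simp
  | add x y _ _ hx hy => rw [inner_add_right, hx, hy, add_zero]
  | smul a x _ hx => rw [inner_smul_right, hx, mul_zero]

/-- `(uR^n, pM^n)`, `n = 0, …, N`, solves the AC-ROM scheme on `XR × QM` with time step `Δt`,
artificial compression parameter `ε` and force values `f^n`. -/
structure IsACROM {Ω : Set (Pt d)} (XR : Submodule ℝ (X Ω)) (QM : Submodule ℝ (L2S Ω))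
    (ν ε Δt : ℝ) (N : ℕ) (f : ℕ → L2V Ω) (uR : ℕ → X Ω) (pM : ℕ → L2S Ω) : Prop where
  mem_XR : ∀ n ≤ N, uR n ∈ XR
  mem_QM : ∀ n ≤ N, pM n ∈ QM
  velocity : ∀ n < N, ∀ φ ∈ XR,
    inner ℝ (Δt⁻¹ • (vel (uR (n + 1)) - vel (uR n))) (vel φ)
      + skewForm (uR n) (uR (n + 1)) φ + ν * inner ℝ (grad (uR (n + 1))) (grad φ)
      - inner ℝ (pM (n + 1)) (divg φ) = inner ℝ (f (n + 1)) (vel φ)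
  pressure : ∀ n < N, ∀ ψ ∈ QM,
    ε * inner ℝ (Δt⁻¹ • (pM (n + 1) - pM n)) ψ + inner ℝ (divg (uR (n + 1))) ψ = 0

/-- The first principal angle between two subspaces. A pair with a zero vector contributes
`arccos (0 / 0) = arccos 0 = π / 2`, the largest possible value. -/
def firstPrincipalAngle {H : Type*} [NormedAddCommGroup H] [InnerProductSpace ℝ H]
    (A B : Submodule ℝ H) : ℝ :=
  sInf {θ | ∃ v ∈ A, ∃ ψ ∈ B, θ = Real.arccos (|inner ℝ v ψ| / (‖v‖ * ‖ψ‖))}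

/-- `α = cos θ₁` for the spaces `span {∇·φ_i}` and `span {ψ_i}`. -/
def angleCos {Ω : Set (Pt d)} {R M : ℕ} (φ : Fin R → X Ω) (ψ : Fin M → L2S Ω) : ℝ :=
  Real.cos (firstPrincipalAngle
    (Submodule.span ℝ (range fun i => divg (φ i))) (Submodule.span ℝ (range ψ)))

/-- The square of the discrete norm `|||v|||_{2,0}`, that is `Δt ∑_{n=0}^{N} ‖v^n‖²`. -/
def discL2sq {H : Type*} [NormedAddCommGroup H] (Δt : ℝ) (N : ℕ) (v : ℕ → H) : ℝ :=
  Δt * ∑ n ∈ Finset.range (N + 1), ‖v n‖ ^ 2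

/-- The energy functional that measures velocity errors `a^n` and pressure errors `b^n`:
`‖a^N‖² + ε‖b^N‖² + (νΔt/2)‖∇a^N‖² + (ν/2)|||∇a|||²_{2,0}
  + ∑_{n=0}^{N-1} (‖a^{n+1} - a^n‖² + (ε/2)‖b^{n+1} - b^n‖²)`. -/
def errEnergy {Ω : Set (Pt d)} (ν ε Δt : ℝ) (N : ℕ) (a : ℕ → X Ω) (b : ℕ → L2S Ω) : ℝ :=
  ‖vel (a N)‖ ^ 2 + ε * ‖b N‖ ^ 2 + ν * Δt / 2 * ‖grad (a N)‖ ^ 2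
    + ν / 2 * discL2sq Δt N (fun n => grad (a n))
    + ∑ n ∈ Finset.range N, (‖vel (a (n + 1)) - vel (a n)‖ ^ 2
        + ε / 2 * ‖b (n + 1) - b n‖ ^ 2)

end ACROM

end

open ACROM MeasureTheory Set

open MeasureTheory Set
open scoped ContDiff ENNReal NNReal Topology

noncomputable section

namespace ACROM

variable {d : ℕ} {Ω : Set (Pt d)}

/-! ### Test functions -/

/-! The total errors split as `e_u = η - ξ` and `e_p = κ - π`: projection errors minus discrete
errors that lie in the reduced spaces. By `L²` orthogonality the values and increments in the energy
split exactly, which is why the energy of `(η, κ)` enters with coefficient one. Gradients are not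
orthogonal and cost an extra `ν |||∇η|||²` (`errEnergy_le`). It remains to bound `ξ` and `π`.

The scheme minus the exact equation at the new time, tested with `ξ'` and `π'` (a prime marks the
new time level), loses the coupling `(π', ∇·ξ')` and all `L²` pairings of projection errors with
reduced functions (`error_identity`). The exact equation is needed at the grid times and with `b*`
in place of `b`: continuity in time gives the former (`IsWeakNSE.momentum_at`), `∇·u = 0` the latter
(`TriBound.conv_skew`). All convection estimates come from `H¹₀ ⊂ L⁶`, in the form `|b(w,u,v)| ≤ L
(‖w‖ ‖∇w‖)^{1/2} ‖∇u‖ ‖∇v‖`.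

Three terms shape the bound (`error_step`). In `b*(ξ, u', ξ')`, with `ξ` at the old time, two
applications of Young's inequality leave `ν/2 ‖∇ξ‖²`, paid for by the gradient part of the old
energy, and a multiple of `‖ξ‖² / ν³`, the source of `exp(C T / ν³)`. The term `b*(u_R, η', ξ')` is
summed with the a priori bounds of the scheme (`IsACROM.stability`) and yields the fourth powers of
`‖∇η‖`. Finally `(∇·η', π')` carries the factor `α`, because `∇·η' = -∇·P_R u'`. Here `π'` is
written as `π + (π' - π)`: the increment is absorbed by the numerical dissipation, the rest by `ε
‖π‖²` with `ε ≥ c₁ Δt`, at the price `α² / Δt` (`pressure_absorb`).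

All growth sits at the old time level, so `discrete_gronwall` needs no smallness of `Δt`. Polynomial
factors in `T` are put into `exp T`, and `ν ≤ ν₀` puts that into the final exponential. -/

lemma jacobian_apply (φ : Pt d → Pt d) (x : Pt d) (ij : Fin d × Fin d) :
    jacobian φ x ij = fderiv ℝ φ x (EuclideanSpace.single ij.2 1) ij.1 := rfl

lemma testPairs_zero : (0 : L2V Ω × L2M Ω) ∈ testPairs Ω := by
  refine ⟨0, contDiff_zero_fun, HasCompactSupport.zero, by simp, ?_, ?_⟩
  · exact Lp.coeFn_zero _ _ _
  · refine (Lp.coeFn_zero _ _ _).trans (Filter.Eventually.of_forall fun x => ?_)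
    ext ij
    simp [jacobian_apply]

lemma testPairs_add {y z : L2V Ω × L2M Ω} (hy : y ∈ testPairs Ω) (hz : z ∈ testPairs Ω) :
    y + z ∈ testPairs Ω := by
  obtain ⟨φ, hφ, hφc, hφs, h1, h2⟩ := hy
  obtain ⟨χ, hχ, hχc, hχs, h3, h4⟩ := hz
  refine ⟨φ + χ, hφ.add hχ, hφc.add hχc,
    (tsupport_add φ χ).trans (union_subset hφs hχs), ?_, ?_⟩
  · exact (Lp.coeFn_add _ _).trans (h1.add h3)
  · refine (Lp.coeFn_add _ _).trans ((h2.add h4).trans (Filter.Eventually.of_forall fun x => ?_))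
    ext ij
    have : fderiv ℝ (φ + χ) x = fderiv ℝ φ x + fderiv ℝ χ x :=
      fderiv_add ((hφ.differentiable (by simp)) x) ((hχ.differentiable (by simp)) x)
    simp [jacobian_apply, this]

lemma testPairs_smul (c : ℝ) {z : L2V Ω × L2M Ω} (hz : z ∈ testPairs Ω) :
    c • z ∈ testPairs Ω := by
  obtain ⟨φ, hφ, hφc, hφs, h1, h2⟩ := hz
  refine ⟨c • φ, contDiff_const.smul hφ, hφc.smul_left (f := fun _ => c),
    (closure_mono (Function.support_const_smul_subset c φ)).trans hφs, ?_, ?_⟩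
  · exact (Lp.coeFn_smul _ _).trans (h1.const_smul c)
  · refine (Lp.coeFn_smul _ _).trans ((h2.const_smul c).trans
      (Filter.Eventually.of_forall fun x => ?_))
    ext ij
    have : fderiv ℝ (c • φ) x = c • fderiv ℝ φ x :=
      fderiv_const_smul ((hφ.differentiable (by simp)) x) c
    simp [jacobian_apply, this]

/-- A closed property of pairs `(v, ∇v)` that holds for test functions holds on `X`. -/
lemma X_induction {P : L2V Ω × L2M Ω → Prop} (hP : IsClosed {z | P z})
    (h : ∀ z ∈ testPairs Ω, P z) (v : X Ω) : P v := by
  let S : Submodule ℝ (L2V Ω × L2M Ω) :=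
    { carrier := testPairs Ω
      add_mem' := testPairs_add
      zero_mem' := testPairs_zero
      smul_mem' := fun c _ hz => testPairs_smul c hz }
  have hle : Submodule.span ℝ (testPairs Ω) ≤ S := Submodule.span_le.mpr fun _ hz => hz
  have hv : (v : L2V Ω × L2M Ω) ∈ closure (Submodule.span ℝ (testPairs Ω) : Set _) := v.2
  exact (closure_minimal (fun z hz => h z (hle hz)) hP) hv

/-- A test pair as a member of `X`. -/
def testMem (z : L2V Ω × L2M Ω) (hz : z ∈ testPairs Ω) : X Ω :=
  ⟨z, Submodule.le_topologicalClosure _ (Submodule.subset_span hz)⟩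

/-- A closed property of members of `X` that holds for test functions holds on `X`. -/
lemma X_induction' {P : X Ω → Prop} (hP : IsClosed {z | P z})
    (h : ∀ z (hz : z ∈ testPairs Ω), P (testMem z hz)) (v : X Ω) : P v := by
  have hcl : IsClosed (Subtype.val '' {z : X Ω | P z}) :=
    (Submodule.isClosed_topologicalClosure _).isClosedEmbedding_subtypeVal.isClosedMap _ hP
  obtain ⟨w, hw, hwv⟩ := X_induction (P := fun z => z ∈ Subtype.val '' {z : X Ω | P z}) hcl
    (fun z hz => ⟨testMem z hz, h z hz, rfl⟩) v
  exact Subtype.ext hwv ▸ hw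

lemma norm_fderiv_le_norm_jacobian (φ : Pt d → Pt d) (x : Pt d) :
    ‖fderiv ℝ φ x‖ ≤ ‖jacobian φ x‖ := by
  refine ContinuousLinearMap.opNorm_le_bound _ (norm_nonneg _) fun y => ?_
  have hy : y = ∑ j, y j • EuclideanSpace.single j (1 : ℝ) := by
    ext i
    simp [Pi.single_apply]
  have hc : ∀ i, fderiv ℝ φ x y i = ∑ j, jacobian φ x (i, j) * y j := by
    intro i
    conv_lhs => rw [hy]
    simp [jacobian_apply, mul_comm]
  rw [← sq_le_sq₀ (norm_nonneg _) (by positivity), mul_pow, EuclideanSpace.real_norm_sq_eq,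
    EuclideanSpace.real_norm_sq_eq, EuclideanSpace.real_norm_sq_eq, Fintype.sum_prod_type,
    Finset.sum_mul]
  refine Finset.sum_le_sum fun i _ => ?_
  rw [hc]
  exact Finset.sum_mul_sq_le_sq_mul_sq _ _ _

lemma continuous_jacobian {φ : Pt d → Pt d} (hφ : ContDiff ℝ ∞ φ) : Continuous (jacobian φ) := by
  refine (PiLp.continuous_toLp 2 _).comp (continuous_pi fun ij => ?_)
  have : Continuous (fderiv ℝ φ) := hφ.continuous_fderiv (by simp)
  exact (EuclideanSpace.proj ij.1).continuous.comp (this.clm_apply continuous_const)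

/-! ### The Sobolev inequality -/

lemma sobolev_smooth {p : ℝ≥0} (hp1 : 1 ≤ p) (hpd : (p : ℝ) < d)
    (hpq : (p : ℝ)⁻¹ - (d : ℝ)⁻¹ ≤ (6 : ℝ)⁻¹) (hΩb : Bornology.IsBounded Ω) :
    ∃ A : ℝ≥0, ∀ φ : Pt d → Pt d, ContDiff ℝ 1 φ → Function.support φ ⊆ Ω →
      eLpNorm φ 6 volume ≤ A * eLpNorm (fderiv ℝ φ) p volume := by
  refine ⟨eLpNormLESNormFDerivOfLeConst (Pt d) (volume : Measure (Pt d)) Ω p 6,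
    fun φ hφ hs => ?_⟩
  have hsob := eLpNorm_le_eLpNorm_fderiv_of_le (volume : Measure (Pt d)) (u := φ) (s := Ω)
    (p := p) (q := 6) hφ hs hp1
    (by rw [finrank_euclideanSpace_fin]; exact_mod_cast hpd)
    (by rw [finrank_euclideanSpace_fin]; exact_mod_cast hpq) hΩb
  rwa [ENNReal.coe_ofNat] at hsob

/-- Two embeddings are chained: the Sobolev inequality from `W^{1,p}` to `L⁶` for some `p ≤ 2`, and
`L² ⊂ L^p` on a set of finite measure. Going through `p` is needed because for `d = 2` the exponent
`2` is the excluded borderline case. -/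
lemma sobolev_test (hd : d = 2 ∨ d = 3) (hΩb : Bornology.IsBounded Ω) :
    ∃ C : ℝ≥0, ∀ z ∈ testPairs Ω,
      eLpNorm z.1 6 (volume.restrict Ω) ≤ C * eLpNorm z.2 2 (volume.restrict Ω) := by
  have hfin : volume Ω < ⊤ := hΩb.measure_lt_top
  -- `p` is chosen with Sobolev conjugate exactly `6`: `2/3 - 1/2 = 1/6` for `d = 2` and `1/2 - 1/3
  -- = 1/6` for `d = 3`.
  obtain ⟨p, hp1, hpd, hpq, hp2⟩ : ∃ p : ℝ≥0, 1 ≤ p ∧ (p : ℝ) < d ∧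
      (p : ℝ)⁻¹ - (d : ℝ)⁻¹ ≤ (6 : ℝ)⁻¹ ∧ p ≤ 2 := by
    rcases hd with rfl | rfl
    · exact ⟨3 / 2, by rw [← NNReal.coe_le_coe]; norm_num, by norm_num, by norm_num,
        by rw [← NNReal.coe_le_coe]; norm_num⟩
    · exact ⟨2, by norm_num, by norm_num, by norm_num, le_rfl⟩
  obtain ⟨A, hA⟩ := sobolev_smooth hp1 hpd hpq hΩb
  have hexp : 0 ≤ 1 / (p : ℝ) - 1 / 2 := by
    rw [sub_nonneg]
    exact one_div_le_one_div_of_le (by exact_mod_cast (zero_lt_one.trans_le hp1))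
      (by exact_mod_cast hp2)
  refine ⟨A * ((volume Ω) ^ (1 / (p : ℝ) - 1 / 2)).toNNReal, ?_⟩
  rintro z ⟨φ, hφ, hφc, hφs, h1, h2⟩
  rw [eLpNorm_congr_ae h1, eLpNorm_congr_ae h2]
  have hsupp : Function.support φ ⊆ Ω := (subset_tsupport φ).trans hφs
  have hfs : Function.support (fderiv ℝ φ) ⊆ Ω := (support_fderiv_subset ℝ).trans hφs
  have hder : eLpNorm (fderiv ℝ φ) p volume ≤
      eLpNorm (jacobian φ) 2 (volume.restrict Ω) * (volume Ω) ^ (1 / (p : ℝ) - 1 / 2) := by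
    rw [← eLpNorm_restrict_eq_of_support_subset (f := fderiv ℝ φ) hfs]
    refine (eLpNorm_mono (norm_fderiv_le_norm_jacobian φ)).trans ?_
    have := eLpNorm_le_eLpNorm_mul_rpow_measure_univ (μ := volume.restrict Ω)
      (p := p) (q := 2) (f := jacobian φ) (by exact_mod_cast hp2)
      (continuous_jacobian hφ).aestronglyMeasurable
    simpa using this
  calc eLpNorm φ 6 (volume.restrict Ω) ≤ eLpNorm φ 6 volume :=
        eLpNorm_mono_measure _ Measure.restrict_le_self
    _ ≤ A * eLpNorm (fderiv ℝ φ) p volume := hA φ (hφ.of_le (by simp)) hsupp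
    _ ≤ A * (eLpNorm (jacobian φ) 2 (volume.restrict Ω) *
        (volume Ω) ^ (1 / (p : ℝ) - 1 / 2)) := by gcongr
    _ = _ := by
        rw [ENNReal.coe_mul, ENNReal.coe_toNNReal
          (ENNReal.rpow_lt_top_of_nonneg hexp hfin.ne).ne]
        ring

/-- The Sobolev embedding `H¹₀ ⊂ L⁶` on a bounded set in dimension two or three. -/
lemma sobolev (hd : d = 2 ∨ d = 3) (hΩb : Bornology.IsBounded Ω) :
    ∃ C : ℝ≥0, ∀ v : X Ω,
      eLpNorm (vel v) 6 (volume.restrict Ω) ≤ C * ENNReal.ofReal ‖grad v‖ := by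
  obtain ⟨C, hC⟩ := sobolev_test hd hΩb
  refine ⟨C, fun v => ?_⟩
  have key : ∀ z : L2V Ω × L2M Ω, ENNReal.ofReal ‖z.2‖ = eLpNorm z.2 2 (volume.restrict Ω) := by
    intro z
    rw [Lp.norm_def, ENNReal.ofReal_toReal (Lp.eLpNorm_ne_top _)]
  refine X_induction (P := fun z => eLpNorm z.1 6 (volume.restrict Ω) ≤ C * ENNReal.ofReal ‖z.2‖)
    ?_ (fun z hz => by rw [key]; exact hC z hz) v
  refine isClosed_of_closure_subset fun z hz => ?_
  obtain ⟨s, hs, hlim⟩ := mem_closure_iff_seq_limit.mp hz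
  have h1 : Filter.Tendsto (fun n => (s n).1) Filter.atTop (𝓝 z.1) :=
    (continuous_fst.tendsto z).comp hlim
  have h2 : Filter.Tendsto (fun n => C * ENNReal.ofReal ‖(s n).2‖) Filter.atTop
      (𝓝 (C * ENNReal.ofReal ‖z.2‖)) := by
    refine ENNReal.Tendsto.const_mul ?_ (Or.inr ENNReal.coe_ne_top)
    exact ((ENNReal.continuous_ofReal.comp (continuous_norm.comp continuous_snd)).tendsto z).comp
      hlim
  -- Convergence in `L²` says nothing about `L⁶` norms, but a subsequence converges almost
  -- everywhere, and Fatou's lemma makes the `L⁶` norm lower semicontinuous along it.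
  obtain ⟨k, hk, hae⟩ := (tendstoInMeasure_of_tendsto_Lp h1).exists_seq_tendsto_ae
  refine (Lp.eLpNorm_lim_le_liminf_eLpNorm
    (fun n => Lp.aestronglyMeasurable (s (k n)).1) z.1 hae).trans ?_
  rw [← (h2.comp hk.tendsto_atTop).liminf_eq]
  exact Filter.liminf_le_liminf (Filter.Eventually.of_forall fun n => hs (k n))

/-- The Poincaré inequality. -/
lemma poincare (hd : d = 2 ∨ d = 3) (hΩb : Bornology.IsBounded Ω) :
    ∃ C : ℝ, 0 ≤ C ∧ ∀ v : X Ω, ‖vel v‖ ≤ C * ‖grad v‖ := by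
  obtain ⟨C, hC⟩ := sobolev (Ω := Ω) hd hΩb
  have hfin : volume Ω < ⊤ := hΩb.measure_lt_top
  refine ⟨C * ((volume Ω) ^ (1 / 2 - 1 / 6 : ℝ)).toReal, by positivity, fun v => ?_⟩
  have h := eLpNorm_le_eLpNorm_mul_rpow_measure_univ (μ := volume.restrict Ω)
          (p := 2) (q := 6) (f := vel v) (by norm_num) (Lp.aestronglyMeasurable _)
  have h' : eLpNorm (vel v) 2 (volume.restrict Ω) ≤
      C * ENNReal.ofReal ‖grad v‖ * (volume Ω) ^ (1 / 2 - 1 / 6 : ℝ) := by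
    refine (h.trans ?_)
    gcongr
    · exact hC v
    · simp
  have hne : (volume Ω) ^ (1 / 2 - 1 / 6 : ℝ) ≠ ⊤ :=
    (ENNReal.rpow_lt_top_of_nonneg (by norm_num) hfin.ne).ne
  rw [Lp.norm_def]
  refine (ENNReal.toReal_mono (by finiteness) h').trans (le_of_eq ?_)
  rw [ENNReal.toReal_mul, ENNReal.toReal_mul, ENNReal.toReal_ofReal (norm_nonneg _)]
  simp only [ENNReal.coe_toReal]
  ring

/-! ### The trilinear form -/

/-- The integrand of the convection term. -/
def convInt (a : Pt d) (G : Mat d) (b : Pt d) : ℝ :=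
  ∑ i : Fin d, ∑ j : Fin d, a j * G (i, j) * b i

lemma convForm_eq (w u v : X Ω) :
    convForm w u v = ∫ x in Ω, convInt (vel w x) (grad u x) (vel v x) := rfl

lemma abs_convInt_le (a : Pt d) (G : Mat d) (b : Pt d) :
    |convInt a G b| ≤ ‖a‖ * ‖G‖ * ‖b‖ := by
  refine abs_le_of_sq_le_sq ?_ (by positivity)
  have h1 : convInt a G b = ∑ ij : Fin d × Fin d, G ij * (b ij.1 * a ij.2) := by
    rw [convInt, Fintype.sum_prod_type]
    exact Finset.sum_congr rfl fun i _ => Finset.sum_congr rfl fun j _ => by ring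
  have h2 : ∑ ij : Fin d × Fin d, (b ij.1 * a ij.2) ^ 2 = ‖b‖ ^ 2 * ‖a‖ ^ 2 := by
    rw [EuclideanSpace.real_norm_sq_eq, EuclideanSpace.real_norm_sq_eq, Fintype.sum_prod_type,
      Finset.sum_mul_sum]
    exact Finset.sum_congr rfl fun i _ => Finset.sum_congr rfl fun j _ => by ring
  calc convInt a G b ^ 2 ≤ (∑ ij, G ij ^ 2) * ∑ ij : Fin d × Fin d, (b ij.1 * a ij.2) ^ 2 := by
        rw [h1]; exact Finset.sum_mul_sq_le_sq_mul_sq _ _ _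
    _ = _ := by rw [h2, ← EuclideanSpace.real_norm_sq_eq]; ring

lemma aestronglyMeasurable_convInt {α : Type*} [MeasurableSpace α] {μ : Measure α}
    {f h : α → Pt d} {g : α → Mat d} (hf : AEStronglyMeasurable f μ)
    (hg : AEStronglyMeasurable g μ) (hh : AEStronglyMeasurable h μ) :
    AEStronglyMeasurable (fun x => convInt (f x) (g x) (h x)) μ := by
  refine Finset.aestronglyMeasurable_fun_sum _ fun i _ =>
    Finset.aestronglyMeasurable_fun_sum _ fun j _ => ?_
  exact (((EuclideanSpace.proj j : Pt d →L[ℝ] ℝ).continuous.comp_aestronglyMeasurable hf).mul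
    ((EuclideanSpace.proj (i, j) : Mat d →L[ℝ] ℝ).continuous.comp_aestronglyMeasurable hg)).mul
    ((EuclideanSpace.proj i : Pt d →L[ℝ] ℝ).continuous.comp_aestronglyMeasurable hh)

/-- The Hölder inequality with exponents `3, 2, 6`, the `L³` norm being interpolated between `L²`
and `L⁶`. -/
lemma lintegral_mul_mul_le {α : Type*} [MeasurableSpace α] {μ : Measure α} {f g h : α → ℝ≥0∞}
    (hf : AEMeasurable f μ) (hg : AEMeasurable g μ) (hh : AEMeasurable h μ) :
    ∫⁻ x, f x * g x * h x ∂μ ≤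
      (∫⁻ x, f x ^ (2 : ℝ) ∂μ) ^ (1 / 4 : ℝ) * (∫⁻ x, f x ^ (6 : ℝ) ∂μ) ^ (1 / 12 : ℝ)
        * (∫⁻ x, g x ^ (2 : ℝ) ∂μ) ^ (1 / 2 : ℝ) * (∫⁻ x, h x ^ (6 : ℝ) ∂μ) ^ (1 / 6 : ℝ) := by
  -- Interpolation and Hölder in one stroke: `f = (f²)^{1/4} (f⁶)^{1/12}`, and the four weights `1/4
  -- + 1/12 + 1/2 + 1/6` add up to `1`.
  have key := ENNReal.lintegral_prod_norm_pow_le (μ := μ) (Finset.univ : Finset (Fin 4))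
    (f := ![fun x => f x ^ (2 : ℝ), fun x => f x ^ (6 : ℝ), fun x => g x ^ (2 : ℝ),
      fun x => h x ^ (6 : ℝ)]) (p := ![1 / 4, 1 / 12, 1 / 2, 1 / 6])
    (by
      intro i _
      fin_cases i
      · exact hf.pow_const _
      · exact hf.pow_const _
      · exact hg.pow_const _
      · exact hh.pow_const _)
    (by simp [Fin.sum_univ_four]; norm_num)
    (by intro i _; fin_cases i <;> simp)
  simp only [Fin.prod_univ_four] at key
  refine le_trans (le_of_eq (lintegral_congr fun x => ?_)) key
  change _ = (f x ^ (2 : ℝ)) ^ (1 / 4 : ℝ) * (f x ^ (6 : ℝ)) ^ (1 / 12 : ℝ) *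
    (g x ^ (2 : ℝ)) ^ (1 / 2 : ℝ) * (h x ^ (6 : ℝ)) ^ (1 / 6 : ℝ)
  rw [← ENNReal.rpow_mul, ← ENNReal.rpow_mul, ← ENNReal.rpow_mul, ← ENNReal.rpow_mul,
    ← ENNReal.rpow_add_of_nonneg _ _ (by norm_num) (by norm_num)]
  norm_num

lemma eLpNorm_six {E α : Type*} [NormedAddCommGroup E] [MeasurableSpace α] {μ : Measure α}
    (f : α → E) : (∫⁻ x, ‖f x‖ₑ ^ (6 : ℝ) ∂μ) ^ (1 / 6 : ℝ) = eLpNorm f 6 μ := by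
  rw [eLpNorm_eq_lintegral_rpow_enorm_toReal (by norm_num) (by norm_num)]
  simp

lemma eLpNorm_two {E α : Type*} [NormedAddCommGroup E] [MeasurableSpace α] {μ : Measure α}
    (f : α → E) : (∫⁻ x, ‖f x‖ₑ ^ (2 : ℝ) ∂μ) ^ (1 / 2 : ℝ) = eLpNorm f 2 μ := by
  rw [eLpNorm_eq_lintegral_rpow_enorm_toReal (by norm_num) (by norm_num)]
  simp

/-- The trilinear estimate, in extended nonnegative reals. -/
lemma lintegral_conv_le (w u v : X Ω) :
    ∫⁻ x in Ω, ‖vel w x‖ₑ * ‖grad u x‖ₑ * ‖vel v x‖ₑ ≤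
      eLpNorm (vel w) 2 (volume.restrict Ω) ^ (1 / 2 : ℝ)
        * eLpNorm (vel w) 6 (volume.restrict Ω) ^ (1 / 2 : ℝ)
        * eLpNorm (grad u) 2 (volume.restrict Ω) * eLpNorm (vel v) 6 (volume.restrict Ω) := by
  refine (lintegral_mul_mul_le (Lp.aestronglyMeasurable _).enorm
    (Lp.aestronglyMeasurable _).enorm (Lp.aestronglyMeasurable _).enorm).trans (le_of_eq ?_)
  rw [← eLpNorm_six (vel v), ← eLpNorm_two (grad u), ← eLpNorm_two (vel w), ← eLpNorm_six (vel w),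
    ← ENNReal.rpow_mul, ← ENNReal.rpow_mul]
  norm_num

/-- The constant of the trilinear estimates and their validity. -/
structure TriBound (Ω : Set (Pt d)) (L : ℝ) : Prop where
  nonneg : 0 ≤ L
  poincare : ∀ v : X Ω, ‖vel v‖ ≤ L * ‖grad v‖
  integrable : ∀ w u v : X Ω,
    IntegrableOn (fun x => convInt (vel w x) (grad u x) (vel v x)) Ω
  conv_le : ∀ w u v : X Ω,
    |convForm w u v| ≤ L * √(‖vel w‖ * ‖grad w‖) * ‖grad u‖ * ‖grad v‖

lemma exists_triBound (hd : d = 2 ∨ d = 3) (hΩb : Bornology.IsBounded Ω) :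
    ∃ L, TriBound Ω L := by
  obtain ⟨C, hC⟩ := sobolev (Ω := Ω) hd hΩb
  obtain ⟨P, hP0, hP⟩ := poincare (Ω := Ω) hd hΩb
  have hn2 : ∀ w : X Ω, eLpNorm (vel w) 2 (volume.restrict Ω) = ENNReal.ofReal ‖vel w‖ := by
    intro w; rw [Lp.norm_def, ENNReal.ofReal_toReal (Lp.eLpNorm_ne_top _)]
  have hg2 : ∀ w : X Ω, eLpNorm (grad w) 2 (volume.restrict Ω) = ENNReal.ofReal ‖grad w‖ := by
    intro w; rw [Lp.norm_def, ENNReal.ofReal_toReal (Lp.eLpNorm_ne_top _)]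
  have hA : 0 ≤ (C : ℝ) ^ (1 / 2 : ℝ) * C := by positivity
  have bound : ∀ w u v : X Ω, ∫⁻ x in Ω, ‖convInt (vel w x) (grad u x) (vel v x)‖ₑ ≤
      ENNReal.ofReal ((C : ℝ) ^ (1 / 2 : ℝ) * C * √(‖vel w‖ * ‖grad w‖) * ‖grad u‖ * ‖grad v‖) := by
    intro w u v
    calc ∫⁻ x in Ω, ‖convInt (vel w x) (grad u x) (vel v x)‖ₑ
        ≤ ∫⁻ x in Ω, ‖vel w x‖ₑ * ‖grad u x‖ₑ * ‖vel v x‖ₑ := by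
          refine lintegral_mono fun x => ?_
          rw [Real.enorm_eq_ofReal_abs, ← ofReal_norm, ← ofReal_norm,
            ← ofReal_norm, ← ENNReal.ofReal_mul (norm_nonneg _),
            ← ENNReal.ofReal_mul (by positivity)]
          exact ENNReal.ofReal_le_ofReal (abs_convInt_le _ _ _)
      _ ≤ _ := lintegral_conv_le w u v
      _ ≤ ENNReal.ofReal ‖vel w‖ ^ (1 / 2 : ℝ) * (C * ENNReal.ofReal ‖grad w‖) ^ (1 / 2 : ℝ)
          * ENNReal.ofReal ‖grad u‖ * (C * ENNReal.ofReal ‖grad v‖) := by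
          rw [hn2, hg2]
          gcongr
          · exact hC w
          · exact hC v
      _ = _ := by
          rw [← ENNReal.ofReal_coe_nnreal, ← ENNReal.ofReal_mul (by positivity),
            ← ENNReal.ofReal_mul (by positivity),
            ENNReal.ofReal_rpow_of_nonneg (by positivity) (by norm_num),
            ENNReal.ofReal_rpow_of_nonneg (by positivity) (by norm_num),
            ← ENNReal.ofReal_mul (by positivity), ← ENNReal.ofReal_mul (by positivity),
            ← ENNReal.ofReal_mul (by positivity)]
          congr 1
          rw [Real.sqrt_eq_rpow, Real.mul_rpow (by positivity) (by positivity),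
            Real.mul_rpow (by positivity) (by positivity)]
          ring
  -- The sum serves as one constant for both the Poincaré and the trilinear bound.
  refine ⟨(C : ℝ) ^ (1 / 2 : ℝ) * C + P, by positivity, fun v => ?_, fun w u v => ?_,
    fun w u v => ?_⟩
  · refine (hP v).trans ?_
    gcongr
    linarith
  · exact ⟨aestronglyMeasurable_convInt (Lp.aestronglyMeasurable _) (Lp.aestronglyMeasurable _)
      (Lp.aestronglyMeasurable _), (bound w u v).trans_lt ENNReal.ofReal_lt_top⟩
  · have h1 : |convForm w u v| ≤
        (C : ℝ) ^ (1 / 2 : ℝ) * C * √(‖vel w‖ * ‖grad w‖) * ‖grad u‖ * ‖grad v‖ := by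
      rw [convForm_eq, ← ENNReal.ofReal_le_ofReal_iff (by positivity), ← Real.enorm_eq_ofReal_abs]
      exact (enorm_integral_le_lintegral_enorm _).trans (bound w u v)
    refine h1.trans ?_
    gcongr
    linarith

namespace TriBound

variable {L : ℝ}

lemma conv_le_grad (h : TriBound Ω L) (w u v : X Ω) :
    |convForm w u v| ≤ L * √L * ‖grad w‖ * ‖grad u‖ * ‖grad v‖ := by
  refine (h.conv_le w u v).trans ?_
  have hL := h.nonneg
  have : √(‖vel w‖ * ‖grad w‖) ≤ √L * ‖grad w‖ := by
    refine Real.sqrt_le_iff.mpr ⟨by positivity, ?_⟩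
    rw [mul_pow, Real.sq_sqrt hL]
    nlinarith [h.poincare w, norm_nonneg (grad w)]
  calc L * √(‖vel w‖ * ‖grad w‖) * ‖grad u‖ * ‖grad v‖
      ≤ L * (√L * ‖grad w‖) * ‖grad u‖ * ‖grad v‖ := by gcongr
    _ = _ := by ring

lemma skew_le (h : TriBound Ω L) (w u v : X Ω) :
    |skewForm w u v| ≤ L * √(‖vel w‖ * ‖grad w‖) * ‖grad u‖ * ‖grad v‖ := by
  have h1 := abs_le.mp (h.conv_le w u v)
  have h2 := abs_le.mp (h.conv_le w v u)
  rw [skewForm, abs_le]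
  constructor <;> nlinarith [h1.1, h1.2, h2.1, h2.2]

lemma skew_le_grad (h : TriBound Ω L) (w u v : X Ω) :
    |skewForm w u v| ≤ L * √L * ‖grad w‖ * ‖grad u‖ * ‖grad v‖ := by
  have h1 := abs_le.mp (h.conv_le_grad w u v)
  have h2 := abs_le.mp (h.conv_le_grad w v u)
  rw [skewForm, abs_le]
  constructor <;> nlinarith [h1.1, h1.2, h2.1, h2.2]

lemma conv_sub_left (h : TriBound Ω L) (w w' u v : X Ω) :
    convForm (w - w') u v = convForm w u v - convForm w' u v := by
  simp only [convForm_eq]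
  rw [← integral_sub (h.integrable w u v) (h.integrable w' u v)]
  refine integral_congr_ae ?_
  filter_upwards [Lp.coeFn_sub (vel w) (vel w')] with x hx
  rw [map_sub, hx]
  simp [convInt, sub_mul, Finset.sum_sub_distrib]

lemma conv_sub_mid (h : TriBound Ω L) (w u u' v : X Ω) :
    convForm w (u - u') v = convForm w u v - convForm w u' v := by
  simp only [convForm_eq]
  rw [← integral_sub (h.integrable w u v) (h.integrable w u' v)]
  refine integral_congr_ae ?_
  filter_upwards [Lp.coeFn_sub (grad u) (grad u')] with x hx
  rw [map_sub, hx]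
  simp [convInt, sub_mul, mul_sub, Finset.sum_sub_distrib]

lemma conv_sub_right (h : TriBound Ω L) (w u v v' : X Ω) :
    convForm w u (v - v') = convForm w u v - convForm w u v' := by
  simp only [convForm_eq]
  rw [← integral_sub (h.integrable w u v) (h.integrable w u v')]
  refine integral_congr_ae ?_
  filter_upwards [Lp.coeFn_sub (vel v) (vel v')] with x hx
  rw [map_sub, hx]
  simp [convInt, mul_sub, Finset.sum_sub_distrib]

lemma skew_sub_left (h : TriBound Ω L) (w w' u v : X Ω) :
    skewForm (w - w') u v = skewForm w u v - skewForm w' u v := by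
  simp only [skewForm, h.conv_sub_left]; ring

lemma skew_sub_mid (h : TriBound Ω L) (w u u' v : X Ω) :
    skewForm w (u - u') v = skewForm w u v - skewForm w u' v := by
  simp only [skewForm, h.conv_sub_mid, h.conv_sub_right]; ring

/-- The convection form is continuous, jointly in its three arguments. -/
lemma tendsto_conv (h : TriBound Ω L) {α : Type*} {l : Filter α} {w u v : α → X Ω}
    {w₀ u₀ v₀ : X Ω} (hw : Filter.Tendsto w l (𝓝 w₀)) (hu : Filter.Tendsto u l (𝓝 u₀))
    (hv : Filter.Tendsto v l (𝓝 v₀)) :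
    Filter.Tendsto (fun t => convForm (w t) (u t) (v t)) l (𝓝 (convForm w₀ u₀ v₀)) := by
  have hg : ∀ {z : α → X Ω} {z₀ : X Ω}, Filter.Tendsto z l (𝓝 z₀) →
      Filter.Tendsto (fun t => ‖grad (z t)‖) l (𝓝 ‖grad z₀‖) := fun hz =>
    ((grad.continuous.tendsto _).comp hz).norm
  have hg0 : ∀ {z : α → X Ω} {z₀ : X Ω}, Filter.Tendsto z l (𝓝 z₀) →
      Filter.Tendsto (fun t => ‖grad (z t - z₀)‖) l (𝓝 0) := fun {z z₀} hz => by
    have := hg (hz.sub_const z₀)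
    simpa using this
  refine tendsto_iff_norm_sub_tendsto_zero.mpr (squeeze_zero (fun _ => norm_nonneg _)
    (g := fun t => L * √L * ‖grad (w t - w₀)‖ * ‖grad (u t)‖ * ‖grad (v t)‖
      + L * √L * ‖grad w₀‖ * ‖grad (u t - u₀)‖ * ‖grad (v t)‖
      + L * √L * ‖grad w₀‖ * ‖grad u₀‖ * ‖grad (v t - v₀)‖) (fun t => ?_) ?_)
  -- The difference of the products telescopes, one argument changing at a time.
  · have e : convForm (w t) (u t) (v t) - convForm w₀ u₀ v₀
        = convForm (w t - w₀) (u t) (v t) + convForm w₀ (u t - u₀) (v t)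
          + convForm w₀ u₀ (v t - v₀) := by
      rw [h.conv_sub_left, h.conv_sub_mid, h.conv_sub_right]; ring
    rw [e, Real.norm_eq_abs]
    refine (abs_add_three _ _ _).trans ?_
    gcongr <;> exact h.conv_le_grad _ _ _
  · have := (((((hg0 hw).const_mul (L * √L)).mul (hg hu)).mul (hg hv)).add
      (((hg0 hu).const_mul (L * √L * ‖grad w₀‖)).mul (hg hv))).add
      ((hg0 hv).const_mul (L * √L * ‖grad w₀‖ * ‖grad u₀‖))
    simpa using this

lemma isClosed_conv_skew (h : TriBound Ω L) (w v : X Ω) :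
    IsClosed {u : X Ω | convForm w u v = -convForm w v u} := by
  refine isClosed_eq (continuous_iff_continuousAt.mpr fun u => ?_)
    (continuous_iff_continuousAt.mpr fun u => ?_)
  · exact h.tendsto_conv tendsto_const_nhds Filter.tendsto_id tendsto_const_nhds
  · exact (h.tendsto_conv tendsto_const_nhds tendsto_const_nhds Filter.tendsto_id).neg

end TriBound

/-! ### Divergence-free fields -/

lemma divg_ae (v : X Ω) :
    divg v =ᵐ[volume.restrict Ω] fun x => ∑ j : Fin d, grad v x (j, j) := by
  filter_upwards [ContinuousLinearMap.coeFn_compLpL (p := 2) (matTrace (d := d)) (grad v)]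
    with x hx
  change (matTrace (d := d)).compLpL 2 (volume.restrict Ω) (grad v) x = _
  rw [hx]
  simp [matTrace]

/-- Integration by parts against a test field. -/
lemma integral_test_mul_fderiv {φ : Pt d → Pt d} (hφ : ContDiff ℝ ∞ φ)
    (hφc : HasCompactSupport φ) {θ : Pt d → ℝ} (hθ : ContDiff ℝ 1 θ) :
    ∫ x, ∑ j, φ x j * fderiv ℝ θ x (EuclideanSpace.single j 1) =
      - ∫ x, (∑ j, jacobian φ x (j, j)) * θ x := by
  have hcomp : ∀ j, ContDiff ℝ 1 fun x => φ x j := fun j =>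
    (EuclideanSpace.proj j : Pt d →L[ℝ] ℝ).contDiff.comp (hφ.of_le (by simp))
  have hsupp : ∀ j, HasCompactSupport fun x => φ x j := fun j =>
    hφc.comp_left (g := fun y : Pt d => y j) rfl
  have hder : ∀ j x, fderiv ℝ (fun x => φ x j) x (EuclideanSpace.single j 1)
      = jacobian φ x (j, j) := by
    intro j x
    have := ((EuclideanSpace.proj j : Pt d →L[ℝ] ℝ).hasFDerivAt.comp x
      (hφ.differentiable (by simp) x).hasFDerivAt).fderiv
    have e : (fun x => φ x j) = (EuclideanSpace.proj j : Pt d →L[ℝ] ℝ) ∘ φ := rfl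
    rw [e, this]
    rfl
  have hjs : ∀ j, HasCompactSupport fun x => jacobian φ x (j, j) := by
    intro j
    have := (hsupp j).fderiv_apply (𝕜 := ℝ) (EuclideanSpace.single j 1)
    simpa only [hder] using this
  have hjc : ∀ j, Continuous fun x => jacobian φ x (j, j) := fun j =>
    (EuclideanSpace.proj (j, j) : Mat d →L[ℝ] ℝ).continuous.comp (continuous_jacobian hφ)
  have hθd : ∀ j, Continuous fun x => fderiv ℝ θ x (EuclideanSpace.single j 1) := fun j =>
    (hθ.continuous_fderiv one_ne_zero).clm_apply continuous_const
  have i1 : ∀ j, Integrable fun x => jacobian φ x (j, j) * θ x := fun j =>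
    ((hjc j).mul hθ.continuous).integrable_of_hasCompactSupport (hjs j).mul_right
  have i2 : ∀ j, Integrable fun x => φ x j * fderiv ℝ θ x (EuclideanSpace.single j 1) := fun j =>
    ((hcomp j).continuous.mul (hθd j)).integrable_of_hasCompactSupport (hsupp j).mul_right
  have i3 : ∀ j, Integrable fun x => φ x j * θ x := fun j =>
    ((hcomp j).continuous.mul hθ.continuous).integrable_of_hasCompactSupport (hsupp j).mul_right
  simp only [Finset.sum_mul]
  rw [integral_finsetSum _ fun j _ => i2 j, integral_finsetSum _ fun j _ => i1 j,
    ← Finset.sum_neg_distrib]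
  refine Finset.sum_congr rfl fun j _ => ?_
  have := integral_mul_fderiv_eq_neg_fderiv_mul_of_integrable (μ := (volume : Measure (Pt d)))
    (f := fun x => φ x j) (g := θ) (v := EuclideanSpace.single j 1)
    (by simpa only [hder] using i1 j) (i2 j) (i3 j)
    (fun x _ => ((hcomp j).differentiable one_ne_zero) x)
    (fun x _ => (hθ.differentiable one_ne_zero) x)
  rw [this]
  simp only [hder]

lemma memLp_of_continuous {E : Type*} [NormedAddCommGroup E] (hΩo : IsOpen Ω)
    (hΩb : Bornology.IsBounded Ω) {g : Pt d → E} (hg : Continuous g) (p : ℝ≥0∞) :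
    MemLp g p (volume.restrict Ω) := by
  have : IsFiniteMeasure (volume.restrict Ω) := ⟨by simpa using hΩb.measure_lt_top⟩
  obtain ⟨C, hC⟩ := (hΩb.isCompact_closure).exists_bound_of_continuousOn hg.continuousOn
  refine MemLp.of_bound hg.aestronglyMeasurable C ?_
  filter_upwards [ae_restrict_mem hΩo.measurableSet] with x hx
  exact hC x (subset_closure hx)

/-- The divergence of a member of `X` is its divergence in the sense of distributions. -/
lemma integral_vel_mul_fderiv (hΩo : IsOpen Ω) (hΩb : Bornology.IsBounded Ω) {θ : Pt d → ℝ}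
    (hθ : ContDiff ℝ 1 θ) (w : X Ω) :
    ∫ x in Ω, ∑ j, vel w x j * fderiv ℝ θ x (EuclideanSpace.single j 1) =
      - ∫ x in Ω, divg w x * θ x := by
  let D : Pt d → Pt d := fun x => WithLp.toLp 2 fun j => fderiv ℝ θ x (EuclideanSpace.single j 1)
  have hD : Continuous D := (PiLp.continuous_toLp 2 _).comp (continuous_pi fun j =>
    (hθ.continuous_fderiv one_ne_zero).clm_apply continuous_const)
  have mD := memLp_of_continuous hΩo hΩb hD 2
  have mθ := memLp_of_continuous hΩo hΩb hθ.continuous 2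
  have e1 : ∀ v : X Ω, inner ℝ (mD.toLp D) (vel v)
      = ∫ x in Ω, ∑ j, vel v x j * fderiv ℝ θ x (EuclideanSpace.single j 1) := by
    intro v
    rw [L2.inner_def]
    refine integral_congr_ae ?_
    filter_upwards [mD.coeFn_toLp] with x hx
    rw [hx, PiLp.inner_apply]
    simp [D]
  have e2 : ∀ v : X Ω, inner ℝ (mθ.toLp θ) (divg v) = ∫ x in Ω, divg v x * θ x := by
    intro v
    rw [L2.inner_def]
    refine integral_congr_ae ?_
    filter_upwards [mθ.coeFn_toLp] with x hx
    rw [hx]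
    simp
  rw [← e1, ← e2]
  -- Written as pairings with the fixed `L²` classes of `∇θ` and `θ`, both sides are continuous in
  -- `w`, so test fields suffice.
  refine X_induction' (P := fun w => inner ℝ (mD.toLp D) (vel w)
    = -inner ℝ (mθ.toLp θ) (divg w)) (isClosed_eq (by fun_prop) (by fun_prop)) ?_ w
  rintro z ⟨φ, hφ, hφc, hφs, h1, h2⟩
  rw [e1, e2]
  -- Test fields vanish off `Ω`, so both integrals extend to the whole space, where integration by
  -- parts has no boundary term.
  have hz : ∀ x ∉ Ω, φ x = 0 := fun x hx => by
    by_contra hne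
    exact hx (hφs (subset_tsupport φ hne))
  have hz' : ∀ x ∉ Ω, fderiv ℝ φ x = 0 := fun x hx => by
    by_contra hne
    exact hx (hφs (support_fderiv_subset ℝ hne))
  have l : ∫ x in Ω, ∑ j, vel (testMem z ⟨φ, hφ, hφc, hφs, h1, h2⟩) x j
      * fderiv ℝ θ x (EuclideanSpace.single j 1)
      = ∫ x, ∑ j, φ x j * fderiv ℝ θ x (EuclideanSpace.single j 1) := by
    refine Eq.trans ?_ (setIntegral_eq_integral_of_forall_compl_eq_zero (s := Ω)
      (fun x hx => by simp [hz x hx]))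
    refine integral_congr_ae ?_
    filter_upwards [h1] with x hx
    change ∑ j, z.1 x j * _ = _
    rw [hx]
  have r : ∫ x in Ω, divg (testMem z ⟨φ, hφ, hφc, hφs, h1, h2⟩) x * θ x
      = ∫ x, (∑ j, jacobian φ x (j, j)) * θ x := by
    refine Eq.trans ?_ (setIntegral_eq_integral_of_forall_compl_eq_zero (s := Ω)
      (fun x hx => by simp [jacobian_apply, hz' x hx]))
    refine integral_congr_ae ?_
    filter_upwards [h2, divg_ae (testMem z ⟨φ, hφ, hφc, hφs, h1, h2⟩)] with x hx hx'
    rw [hx']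
    change (∑ j, z.2 x (j, j)) * _ = _
    rw [hx]
  rw [l, r]
  exact integral_test_mul_fderiv hφ hφc hθ

/-- The case `θ = 1` of integration by parts. It makes `∇·u` itself an admissible test function in
the continuity equation. -/
lemma meanZero_divg (hΩo : IsOpen Ω) (hΩb : Bornology.IsBounded Ω) (w : X Ω) :
    MeanZero (divg w) := by
  have := integral_vel_mul_fderiv hΩo hΩb (θ := fun _ => (1 : ℝ)) contDiff_const w
  simpa [MeanZero] using this

lemma fderiv_inner_single {φ χ : Pt d → Pt d} (hφ : ContDiff ℝ ∞ φ) (hχ : ContDiff ℝ ∞ χ)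
    (x : Pt d) (j : Fin d) :
    fderiv ℝ (fun x => inner ℝ (φ x) (χ x)) x (EuclideanSpace.single j 1)
      = ∑ i, (jacobian φ x (i, j) * χ x i + jacobian χ x (i, j) * φ x i) := by
  rw [fderiv_inner_apply ℝ (hφ.differentiable (by simp) x) (hχ.differentiable (by simp) x),
    PiLp.inner_apply, PiLp.inner_apply, ← Finset.sum_add_distrib]
  refine Finset.sum_congr rfl fun i _ => ?_
  simp [jacobian_apply]
  ring

/-- The convection form of a divergence-free field is skew-symmetric. -/
lemma TriBound.conv_skew {L : ℝ} (h : TriBound Ω L) (hΩo : IsOpen Ω)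
    (hΩb : Bornology.IsBounded Ω) {w : X Ω} (hw : divg w = 0) (u v : X Ω) :
    convForm w u v = -convForm w v u := by
  refine X_induction' (P := fun u => convForm w u v = -convForm w v u)
    (h.isClosed_conv_skew w v) (fun y hy => ?_) u
  -- The identity is symmetric in `u` and `v`; exchanging them lets the same closedness lemma serve
  -- for the second density argument.
  rw [eq_neg_iff_add_eq_zero, add_comm, ← eq_neg_iff_add_eq_zero]
  refine X_induction' (P := fun v => convForm w v (testMem y hy) = -convForm w (testMem y hy) v)
    (h.isClosed_conv_skew w _) (fun z hz => ?_) v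
  obtain ⟨φ, hφ, hφc, hφs, h1, h2⟩ := id hy
  obtain ⟨χ, hχ, hχc, hχs, h3, h4⟩ := id hz
  -- The sum of the two forms is the integral of `w · ∇(φ · χ)`, which equals `-(∇·w, φ · χ) = 0`.
  have hθ : ContDiff ℝ 1 fun x => inner ℝ (φ x) (χ x) := (hφ.inner ℝ hχ).of_le (by simp)
  have key := integral_vel_mul_fderiv hΩo hΩb hθ w
  have hzero : ∫ x in Ω, divg w x * inner ℝ (φ x) (χ x) = 0 := by
    refine integral_eq_zero_of_ae ?_
    filter_upwards [Lp.coeFn_zero ℝ 2 (volume.restrict Ω)] with x hx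
    have hx' : divg w x = 0 := by rw [hw]; exact hx
    simp [hx']
  rw [hzero, neg_zero] at key
  rw [eq_neg_iff_add_eq_zero, ← key, convForm_eq, convForm_eq,
    ← integral_add (h.integrable _ _ _) (h.integrable _ _ _)]
  refine integral_congr_ae ?_
  filter_upwards [h1, h2, h3, h4] with x e1 e2 e3 e4
  change convInt (vel w x) (z.2 x) (y.1 x) + convInt (vel w x) (y.2 x) (z.1 x) = _
  rw [e1, e2, e3, e4]
  simp only [fderiv_inner_single hφ hχ, convInt, ← Finset.sum_add_distrib]
  rw [Finset.sum_comm]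
  refine Finset.sum_congr rfl fun j _ => ?_
  rw [Finset.mul_sum]
  exact Finset.sum_congr rfl fun i _ => by ring

lemma TriBound.conv_eq_skewForm {L : ℝ} (h : TriBound Ω L) (hΩo : IsOpen Ω)
    (hΩb : Bornology.IsBounded Ω) {w : X Ω} (hw : divg w = 0) (u v : X Ω) :
    convForm w u v = skewForm w u v := by
  rw [skewForm, h.conv_skew hΩo hΩb hw v u]
  ring

lemma skewForm_self (w v : X Ω) : skewForm w v v = 0 := by
  rw [skewForm]; ring

lemma norm_divg_le (v : X Ω) : ‖divg v‖ ≤ ‖matTrace (d := d)‖ * ‖grad v‖ := by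
  exact (matTrace (d := d)).norm_compLp_le (grad v)

/-! ### Regularity in time -/

section Time

variable {E : Type*} [NormedAddCommGroup E] {T a b : ℝ} {g : ℝ → E}

lemma intervalIntegrable_of_memLp {q : ℝ≥0∞} (hq : 1 ≤ q)
    (hg : MemLp g q (volume.restrict (Ioc 0 T))) (ha : 0 ≤ a) (hab : a ≤ b) (hb : b ≤ T) :
    IntervalIntegrable g volume a b := by
  rw [intervalIntegrable_iff_integrableOn_Ioc_of_le hab]
  have : IntegrableOn g (Ioc 0 T) := hg.integrable hq
  exact this.mono_set (Ioc_subset_Ioc ha hb)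

lemma intervalIntegrable_norm_sq (hg : MemLp g 2 (volume.restrict (Ioc 0 T))) (ha : 0 ≤ a)
    (hab : a ≤ b) (hb : b ≤ T) : IntervalIntegrable (fun s => ‖g s‖ ^ 2) volume a b := by
  rw [intervalIntegrable_iff_integrableOn_Ioc_of_le hab]
  have : IntegrableOn (fun s => ‖g s‖ ^ 2) (Ioc 0 T) := hg.integrable_norm_pow two_ne_zero
  exact this.mono_set (Ioc_subset_Ioc ha hb)

/-- The Cauchy–Schwarz inequality on a time interval. -/
lemma sq_integral_norm_le (hg : MemLp g 2 (volume.restrict (Ioc 0 T))) (ha : 0 ≤ a)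
    (hab : a ≤ b) (hb : b ≤ T) :
    (∫ s in a..b, ‖g s‖) ^ 2 ≤ (b - a) * ∫ s in a..b, ‖g s‖ ^ 2 := by
  rcases hab.eq_or_lt with rfl | hlt
  · simp
  have i1 : IntervalIntegrable (fun s => ‖g s‖) volume a b :=
    (intervalIntegrable_of_memLp (by norm_num) hg ha hab hb).norm
  have i2 := intervalIntegrable_norm_sq hg ha hab hb
  set I := ∫ s in a..b, ‖g s‖
  set c := I / (b - a)
  have h0 : 0 ≤ ∫ s in a..b, (‖g s‖ - c) ^ 2 :=
    intervalIntegral.integral_nonneg hab fun s _ => sq_nonneg _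
  -- `c` is the mean of `‖g‖`; nonnegativity of its variance is the claim.
  have e : ∫ s in a..b, (‖g s‖ - c) ^ 2
      = (∫ s in a..b, ‖g s‖ ^ 2) - 2 * c * I + c ^ 2 * (b - a) := by
    have : ∀ s, (‖g s‖ - c) ^ 2 = ‖g s‖ ^ 2 - 2 * c * ‖g s‖ + c ^ 2 := fun s => by ring
    simp only [this]
    rw [intervalIntegral.integral_add (i2.sub (i1.const_mul _)) intervalIntegrable_const,
      intervalIntegral.integral_sub i2 (i1.const_mul _), intervalIntegral.integral_const_mul,
      intervalIntegral.integral_const, smul_eq_mul]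
    ring
  have hba : 0 < b - a := sub_pos.mpr hlt
  have hc : c * (b - a) = I := div_mul_cancel₀ _ hba.ne'
  rw [e] at h0
  have h1 : 0 ≤ (b - a) * ((∫ s in a..b, ‖g s‖ ^ 2) - 2 * c * I + c ^ 2 * (b - a)) := by positivity
  have h2 : (b - a) * ((∫ s in a..b, ‖g s‖ ^ 2) - 2 * c * I + c ^ 2 * (b - a))
      = (b - a) * (∫ s in a..b, ‖g s‖ ^ 2) - 2 * (c * (b - a)) * I + (c * (b - a)) ^ 2 := by ring
  rw [h2, hc] at h1
  linarith

variable [NormedSpace ℝ E]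

lemma primitive_sub {q : ℝ≥0∞} (hq : 1 ≤ q) (hg : MemLp g q (volume.restrict (Ioc 0 T)))
    (ha : 0 ≤ a) (hab : a ≤ b) (hb : b ≤ T) :
    (∫ s in (0 : ℝ)..b, g s) - ∫ s in (0 : ℝ)..a, g s = ∫ s in a..b, g s :=
  intervalIntegral.integral_interval_sub_left
    (intervalIntegrable_of_memLp hq hg le_rfl (ha.trans hab) hb)
    (intervalIntegrable_of_memLp hq hg le_rfl ha (hab.trans hb))

lemma continuousOn_primitive {q : ℝ≥0∞} (hq : 1 ≤ q)
    (hg : MemLp g q (volume.restrict (Ioc 0 T))) (hT : 0 ≤ T) :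
    ContinuousOn (fun t => ∫ s in (0 : ℝ)..t, g s) (Icc 0 T) := by
  have h := intervalIntegral.continuousOn_primitive_interval' (μ := volume) (a := 0)
    (intervalIntegrable_of_memLp hq hg le_rfl hT le_rfl) (by simp)
  rwa [uIcc_of_le hT] at h

lemma norm_sub_le_of_primitive {v : ℝ → E} (hv : ∀ t ∈ Icc 0 T, v t = v 0 + ∫ s in (0 : ℝ)..t, g s)
    (hg : MemLp g ⊤ (volume.restrict (Ioc 0 T))) (ha : 0 ≤ a) (hab : a ≤ b) (hb : b ≤ T) :
    ‖v b - v a‖ ≤ (b - a) * (eLpNorm g ⊤ (volume.restrict (Ioc 0 T))).toReal := by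
  rw [hv b ⟨ha.trans hab, hb⟩, hv a ⟨ha, hab.trans hb⟩, add_sub_add_left_eq_sub,
    primitive_sub le_top hg ha hab hb]
  have hbd : ∀ᵐ t ∂(volume.restrict (Ioc 0 T)),
      ‖g t‖ ≤ (eLpNorm g ⊤ (volume.restrict (Ioc 0 T))).toReal := by
    have hne : eLpNorm g ⊤ (volume.restrict (Ioc 0 T)) ≠ ⊤ := hg.2.ne
    filter_upwards [ae_le_eLpNormEssSup (f := g) (μ := volume.restrict (Ioc 0 T))] with t ht
    rw [← eLpNorm_exponent_top] at ht
    have := ENNReal.toReal_mono hne ht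
    simpa using this
  rw [ae_restrict_iff' measurableSet_Ioc] at hbd
  have := intervalIntegral.norm_integral_le_of_norm_le_const_ae (a := a) (b := b) (f := g)
    (C := (eLpNorm g ⊤ (volume.restrict (Ioc 0 T))).toReal) (by
      filter_upwards [hbd] with t ht hmem
      rw [uIoc_of_le hab] at hmem
      exact ht ⟨ha.trans_lt hmem.1, hmem.2.trans hb⟩)
  rwa [abs_of_nonneg (sub_nonneg.mpr hab), mul_comm] at this

end Time

namespace IsTimeRegular

variable {T : ℝ} {f : ℝ → L2V Ω} {u ut : ℝ → X Ω} {utt : ℝ → L2V Ω} {p pt : ℝ → L2S Ω}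

lemma continuousOn_u (h : IsTimeRegular Ω T f u ut utt p pt) (hT : 0 ≤ T) :
    ContinuousOn u (Icc 0 T) :=
  (continuousOn_const.add (continuousOn_primitive (by norm_num) h.ut_mem hT)).congr h.u_eq

lemma continuousOn_p (h : IsTimeRegular Ω T f u ut utt p pt) (hT : 0 ≤ T) :
    ContinuousOn p (Icc 0 T) :=
  (continuousOn_const.add (continuousOn_primitive le_top h.pt_mem hT)).congr h.p_eq

lemma sq_norm_grad_sub_le (h : IsTimeRegular Ω T f u ut utt p pt) {a b : ℝ} (ha : 0 ≤ a)
    (hab : a ≤ b) (hb : b ≤ T) :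
    ‖grad (u b - u a)‖ ^ 2 ≤ (b - a) * ∫ s in a..b, ‖grad (ut s)‖ ^ 2 := by
  have hg : MemLp (fun s => grad (ut s)) 2 (volume.restrict (Ioc 0 T)) :=
    grad.comp_memLp' h.ut_mem
  rw [h.u_eq b ⟨ha.trans hab, hb⟩, h.u_eq a ⟨ha, hab.trans hb⟩, add_sub_add_left_eq_sub,
    primitive_sub (by norm_num) h.ut_mem ha hab hb,
    ← grad.intervalIntegral_comp_comm
      (intervalIntegrable_of_memLp (by norm_num) h.ut_mem ha hab hb)]
  refine le_trans ?_ (sq_integral_norm_le hg ha hab hb)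
  gcongr
  exact intervalIntegral.norm_integral_le_integral_norm hab

/-- The truncation error of the backward difference quotient. -/
lemma sq_norm_truncation_le (h : IsTimeRegular Ω T f u ut utt p pt) {a₀ : L2V Ω}
    (ha₀ : ∀ᵐ t ∂(volume.restrict (Ioc 0 T)), vel (ut t) = a₀ + ∫ s in (0 : ℝ)..t, utt s)
    {a b : ℝ} (ha : 0 ≤ a) (hab : a < b) (hb : b ≤ T) :
    ‖(b - a)⁻¹ • (vel (u b) - vel (u a)) - (a₀ + ∫ s in (0 : ℝ)..b, utt s)‖ ^ 2
      ≤ (b - a) * ∫ s in a..b, ‖utt s‖ ^ 2 := by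
  have hba : 0 < b - a := sub_pos.mpr hab
  refine le_trans ?_ (sq_integral_norm_le h.utt_mem ha hab.le hb)
  gcongr
  set w := a₀ + ∫ s in (0 : ℝ)..b, utt s with hw
  have hv : MemLp (fun s => vel (ut s)) 2 (volume.restrict (Ioc 0 T)) :=
    vel.comp_memLp' h.ut_mem
  have iv := intervalIntegrable_of_memLp (by norm_num) hv ha hab.le hb
  have e1 : vel (u b) - vel (u a) = ∫ s in a..b, vel (ut s) := by
    rw [← map_sub, h.u_eq b ⟨ha.trans hab.le, hb⟩, h.u_eq a ⟨ha, hab.le.trans hb⟩,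
      add_sub_add_left_eq_sub, primitive_sub (by norm_num) h.ut_mem ha hab.le hb,
      vel.intervalIntegral_comp_comm
        (intervalIntegrable_of_memLp (by norm_num) h.ut_mem ha hab.le hb)]
  -- The truncation error is the mean of `u_t(s) - u_t(b)` over the step, with `w` the continuous
  -- representative of `u_t` at `b`.
  have e2 : (b - a)⁻¹ • (vel (u b) - vel (u a)) - w
      = (b - a)⁻¹ • ∫ s in a..b, (vel (ut s) - w) := by
    rw [e1, intervalIntegral.integral_sub iv intervalIntegrable_const,
      intervalIntegral.integral_const, smul_sub, smul_smul, inv_mul_cancel₀ hba.ne', one_smul]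
  have bd : ‖∫ s in a..b, (vel (ut s) - w)‖ ≤ (∫ s in a..b, ‖utt s‖) * |b - a| := by
    refine intervalIntegral.norm_integral_le_of_norm_le_const_ae ?_
    rw [ae_restrict_iff' measurableSet_Ioc] at ha₀
    filter_upwards [ha₀] with s hs hmem
    rw [uIoc_of_le hab.le] at hmem
    have hs0 : 0 ≤ s := ha.trans hmem.1.le
    rw [hs ⟨ha.trans_lt hmem.1, hmem.2.trans hb⟩, hw, add_sub_add_left_eq_sub, ← norm_neg,
      neg_sub, primitive_sub (by norm_num) h.utt_mem hs0 hmem.2 hb]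
    refine (intervalIntegral.norm_integral_le_integral_norm hmem.2).trans ?_
    refine intervalIntegral.integral_mono_interval hmem.1.le hmem.2 le_rfl
      (Filter.Eventually.of_forall fun _ => norm_nonneg _)
      (intervalIntegrable_of_memLp (by norm_num) h.utt_mem ha hab.le hb).norm
  rw [e2, norm_smul, norm_inv, Real.norm_eq_abs]
  rw [abs_of_pos hba] at bd ⊢
  calc (b - a)⁻¹ * ‖∫ s in a..b, (vel (ut s) - w)‖
      ≤ (b - a)⁻¹ * ((∫ s in a..b, ‖utt s‖) * (b - a)) := by gcongr
    _ = _ := by field_simp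

end IsTimeRegular

namespace IsWeakNSE

variable {ν T : ℝ} {f : ℝ → L2V Ω} {u₀ : X Ω} {u ut : ℝ → X Ω} {utt : ℝ → L2V Ω}
  {p pt : ℝ → L2S Ω}

lemma eq_zero_of_ae {E : Type*} [NormedAddCommGroup E] (hT : 0 < T) {g : ℝ → E}
    (hg : ContinuousOn g (Icc 0 T)) (h : ∀ᵐ t ∂(volume.restrict (Ioc 0 T)), g t = 0) {t : ℝ}
    (ht : t ∈ Icc 0 T) : g t = 0 := by
  rw [restrict_Ioc_eq_restrict_Icc] at h
  exact Measure.eqOn_Icc_of_ae_eq volume hT.ne h hg continuousOn_const ht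

lemma divg_eq_zero (h : IsWeakNSE Ω ν T f u₀ u ut p)
    (hr : IsTimeRegular Ω T f u ut utt p pt) (hΩo : IsOpen Ω) (hΩb : Bornology.IsBounded Ω)
    (hT : 0 < T) {t : ℝ} (ht : t ∈ Icc 0 T) : divg (u t) = 0 := by
  refine eq_zero_of_ae hT (g := fun t => divg (u t))
    (divg.continuous.comp_continuousOn (hr.continuousOn_u hT.le)) ?_ ht
  filter_upwards [h.continuity] with s hs
  exact inner_self_eq_zero.mp (hs _ (meanZero_divg hΩo hΩb _))

/-- The momentum equation holds at every time, not just almost every one. -/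
lemma momentum_at {L : ℝ} (hL : TriBound Ω L) (h : IsWeakNSE Ω ν T f u₀ u ut p)
    (hr : IsTimeRegular Ω T f u ut utt p pt) (hT : 0 < T) {a₀ : L2V Ω}
    (ha₀ : ∀ᵐ t ∂(volume.restrict (Ioc 0 T)), vel (ut t) = a₀ + ∫ s in (0 : ℝ)..t, utt s)
    {t : ℝ} (ht : t ∈ Icc 0 T) (v : X Ω) :
    inner ℝ (a₀ + ∫ s in (0 : ℝ)..t, utt s) (vel v) + convForm (u t) (u t) v
      + ν * inner ℝ (grad (u t)) (grad v) - inner ℝ (p t) (divg v) = inner ℝ (f t) (vel v) := by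
  rw [← sub_eq_zero]
  have hu := hr.continuousOn_u hT.le
  refine eq_zero_of_ae hT (g := fun t => inner ℝ (a₀ + ∫ s in (0 : ℝ)..t, utt s) (vel v)
    + convForm (u t) (u t) v + ν * inner ℝ (grad (u t)) (grad v) - inner ℝ (p t) (divg v)
    - inner ℝ (f t) (vel v)) ?_ ?_ ht
  · have c1 : ContinuousOn (fun t => inner ℝ (a₀ + ∫ s in (0 : ℝ)..t, utt s) (vel v)) (Icc 0 T) :=
      (continuousOn_const.add (continuousOn_primitive (by norm_num) hr.utt_mem hT.le)).inner
        continuousOn_const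
    have c2 : ContinuousOn (fun t => convForm (u t) (u t) v) (Icc 0 T) := fun s hs =>
      hL.tendsto_conv (hu s hs) (hu s hs) tendsto_const_nhds
    have c3 : ContinuousOn (fun t => ν * inner ℝ (grad (u t)) (grad v)) (Icc 0 T) :=
      continuousOn_const.mul ((grad.continuous.comp_continuousOn hu).inner continuousOn_const)
    have c4 : ContinuousOn (fun t => inner ℝ (p t) (divg v)) (Icc 0 T) :=
      (hr.continuousOn_p hT.le).inner continuousOn_const
    have c5 : ContinuousOn (fun t => inner ℝ (f t) (vel v)) (Icc 0 T) :=
      hr.f_cont.inner continuousOn_const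
    exact (((c1.add c2).add c3).sub c4).sub c5
  · filter_upwards [h.momentum, ha₀] with s hs hs'
    -- The exceptional null set does not depend on `v`. Replacing `u_t` by its continuous
    -- representative is what allows the passage to every `t`.
    rw [← hs', hs v, sub_self]

end IsWeakNSE

/-! ### Discrete estimates -/

/-- The quantity to propagate is `S n` plus the dissipation accumulated so far: it obeys the same
recursion, since enlarging the dissipation by the factor `1 + a` only helps. -/
lemma discrete_gronwall {S D F : ℕ → ℝ} {a : ℝ} (ha : 0 ≤ a) (hS : 0 ≤ S 0) (hD : ∀ n, 0 ≤ D n)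
    (hF : ∀ n, 0 ≤ F n) {N : ℕ} (h : ∀ n < N, S (n + 1) + D n ≤ (1 + a) * S n + F n) :
    S N + ∑ n ∈ Finset.range N, D n ≤
      Real.exp (a * N) * (S 0 + ∑ n ∈ Finset.range N, F n) := by
  suffices H : ∀ n ≤ N, S n + ∑ k ∈ Finset.range n, D k ≤
      Real.exp (a * n) * (S 0 + ∑ k ∈ Finset.range n, F k) from H N le_rfl
  intro n
  induction n with
  | zero => simp
  | succ n ih =>
    intro hn
    have h1 := ih (by omega)
    have h2 := h n (by omega)
    have hs : 0 ≤ ∑ k ∈ Finset.range n, D k := Finset.sum_nonneg fun k _ => hD k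
    have hz : S (n + 1) + ∑ k ∈ Finset.range (n + 1), D k
        ≤ (1 + a) * (S n + ∑ k ∈ Finset.range n, D k) + F n := by
      rw [Finset.sum_range_succ]
      nlinarith [mul_nonneg ha hs]
    have hexp : Real.exp (a * (n + 1 : ℕ)) = Real.exp a * Real.exp (a * n) := by
      rw [← Real.exp_add]; congr 1; push_cast; ring
    have he : 1 + a ≤ Real.exp a := by linarith [Real.add_one_le_exp a]
    have h1e : 1 ≤ Real.exp (a * (n + 1 : ℕ)) := Real.one_le_exp (by positivity)
    set Z := S n + ∑ k ∈ Finset.range n, D k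
    set Y := S 0 + ∑ k ∈ Finset.range n, F k with hY
    calc S (n + 1) + ∑ k ∈ Finset.range (n + 1), D k ≤ (1 + a) * Z + F n := hz
      _ ≤ (1 + a) * (Real.exp (a * n) * Y) + F n := by gcongr
      _ ≤ Real.exp a * (Real.exp (a * n) * Y) + Real.exp (a * (n + 1 : ℕ)) * F n := by
        have hY0 : 0 ≤ Y := add_nonneg hS (Finset.sum_nonneg fun k _ => hF k)
        have hFn := hF n
        gcongr
        exact le_mul_of_one_le_left hFn h1e
      _ = _ := by rw [Finset.sum_range_succ, hexp, hY]; ring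

/-- The strengthened Cauchy–Schwarz inequality for the first principal angle. -/
lemma abs_inner_le_cos_firstPrincipalAngle {H : Type*} [NormedAddCommGroup H]
    [InnerProductSpace ℝ H] {A B : Submodule ℝ H} {v ψ : H} (hv : v ∈ A) (hψ : ψ ∈ B) :
    |inner ℝ v ψ| ≤ Real.cos (firstPrincipalAngle A B) * (‖v‖ * ‖ψ‖) := by
  have hr0 : 0 ≤ |inner ℝ v ψ| / (‖v‖ * ‖ψ‖) := by positivity
  have hr1 : |inner ℝ v ψ| / (‖v‖ * ‖ψ‖) ≤ 1 := by
    have := abs_real_inner_div_norm_mul_norm_le_one v ψ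
    rwa [abs_div, abs_of_nonneg (by positivity : 0 ≤ ‖v‖ * ‖ψ‖)] at this
  have hle : firstPrincipalAngle A B ≤ Real.arccos (|inner ℝ v ψ| / (‖v‖ * ‖ψ‖)) := by
    refine csInf_le ⟨0, ?_⟩ ⟨v, hv, ψ, hψ, rfl⟩
    rintro θ ⟨x, _, y, _, rfl⟩
    exact Real.arccos_nonneg _
  have h0 : 0 ≤ firstPrincipalAngle A B := by
    refine Real.sInf_nonneg ?_
    rintro θ ⟨x, _, y, _, rfl⟩
    exact Real.arccos_nonneg _
  have hcos := Real.cos_le_cos_of_nonneg_of_le_pi h0 (Real.arccos_le_pi _) hle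
  rw [Real.cos_arccos (by linarith) hr1] at hcos
  rcases eq_or_ne (‖v‖ * ‖ψ‖) 0 with h | h
  · have := abs_real_inner_le_norm v ψ
    rw [h] at this ⊢
    linarith
  · rwa [div_le_iff₀ (by positivity)] at hcos

/-- The Poincaré inequality bounds the quotients, so the supremum is a genuine one; it also forces
`v = 0` in `L²` when the gradient vanishes. -/
lemma TriBound.inner_le_negNorm {L : ℝ} (h : TriBound Ω L) (g : L2V Ω) (v : X Ω) :
    inner ℝ g (vel v) ≤ negNorm g * ‖grad v‖ := by
  have hL := h.nonneg
  rcases eq_or_ne ‖grad v‖ 0 with h0 | h0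
  · have hv := h.poincare v
    rw [h0, mul_zero] at hv
    have : vel v = 0 := norm_le_zero_iff.mp hv
    simp [this, h0]
  · rw [← div_le_iff₀ (by positivity)]
    refine le_ciSup (f := fun v : X Ω => inner ℝ g (vel v) / ‖grad v‖) ⟨‖g‖ * L, ?_⟩ v
    rintro _ ⟨w, rfl⟩
    refine div_le_of_le_mul₀ (norm_nonneg _) (by positivity) ?_
    calc inner ℝ g (vel w) ≤ ‖g‖ * ‖vel w‖ := real_inner_le_norm _ _
      _ ≤ ‖g‖ * (L * ‖grad w‖) := by gcongr; exact h.poincare w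
      _ = _ := by ring

lemma two_inner_sub_self {H : Type*} [NormedAddCommGroup H] [InnerProductSpace ℝ H] (x y : H) :
    2 * inner ℝ (x - y) x = ‖x‖ ^ 2 - ‖y‖ ^ 2 + ‖x - y‖ ^ 2 := by
  rw [norm_sub_sq_real, inner_sub_left, real_inner_self_eq_norm_sq, real_inner_comm]
  ring

/-! ### Stability of the scheme -/

namespace IsACROM

variable {XR : Submodule ℝ (X Ω)} {QM : Submodule ℝ (L2S Ω)} {ν ε Δt L : ℝ} {N : ℕ}
  {f : ℕ → L2V Ω} {uR : ℕ → X Ω} {pM : ℕ → L2S Ω}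

/-- One step of the energy estimate for the scheme. -/
lemma energy_step (h : IsACROM XR QM ν ε Δt N f uR pM) (hL : TriBound Ω L) (hν : 0 < ν)
    (hε : 0 < ε) (hΔ : 0 < Δt) {n : ℕ} (hn : n < N) :
    ‖vel (uR (n + 1))‖ ^ 2 + ε * ‖pM (n + 1)‖ ^ 2 + ν * Δt * ‖grad (uR (n + 1))‖ ^ 2
      ≤ ‖vel (uR n)‖ ^ 2 + ε * ‖pM n‖ ^ 2 + Δt / ν * negNorm (f (n + 1)) ^ 2 := by
  have hv := h.velocity n hn _ (h.mem_XR (n + 1) hn)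
  have hp := h.pressure n hn _ (h.mem_QM (n + 1) hn)
  rw [skewForm_self, inner_smul_left, real_inner_self_eq_norm_sq] at hv
  rw [inner_smul_left, real_inner_comm (pM (n + 1)) (divg (uR (n + 1)))] at hp
  simp only [conj_trivial] at hv hp
  have e1 := two_inner_sub_self (vel (uR (n + 1))) (vel (uR n))
  have e2 := two_inner_sub_self (pM (n + 1)) (pM n)
  have hf := hL.inner_le_negNorm (f (n + 1)) (uR (n + 1))
  set a := inner ℝ (vel (uR (n + 1)) - vel (uR n)) (vel (uR (n + 1)))
  set b := inner ℝ (pM (n + 1) - pM n) (pM (n + 1))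
  set c := inner ℝ (pM (n + 1)) (divg (uR (n + 1)))
  set G := ‖grad (uR (n + 1))‖
  set q := negNorm (f (n + 1))
  have hsum : a + ν * Δt * G ^ 2 + ε * b ≤ Δt * (q * G) := by
    -- The pressure pairing `c` occurs in the two equations with opposite signs and cancels.
    have e : a + ν * Δt * G ^ 2 + ε * b = Δt * inner ℝ (f (n + 1)) (vel (uR (n + 1))) := by
      field_simp at hv hp
      linear_combination hv + hp
    rw [e]
    gcongr
  have hy : 2 * (q * G) ≤ ν * G ^ 2 + q ^ 2 / ν := by
    have : ν * G ^ 2 + q ^ 2 / ν - 2 * (q * G) = (ν * G - q) ^ 2 / ν := by field_simp; ring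
    have h0 : 0 ≤ (ν * G - q) ^ 2 / ν := by positivity
    linarith
  have hy' : Δt * (2 * (q * G)) ≤ ν * Δt * G ^ 2 + Δt / ν * q ^ 2 := by
    calc Δt * (2 * (q * G)) ≤ Δt * (ν * G ^ 2 + q ^ 2 / ν) := by gcongr
      _ = _ := by ring
  have h1 : 0 ≤ ‖vel (uR (n + 1)) - vel (uR n)‖ ^ 2 := sq_nonneg _
  have h2 : 0 ≤ ε * ‖pM (n + 1) - pM n‖ ^ 2 := by positivity
  have h3 : ε * (2 * b) = ε * ‖pM (n + 1)‖ ^ 2 - ε * ‖pM n‖ ^ 2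
      + ε * ‖pM (n + 1) - pM n‖ ^ 2 := by rw [e2]; ring
  linarith

/-- Summing `energy_step` bounds the new-level gradients; the error recursion needs those at the old
level. -/
lemma stability (h : IsACROM XR QM ν ε Δt N f uR pM) (hL : TriBound Ω L) (hν : 0 < ν)
    (hε : 0 < ε) (hΔ : 0 < Δt) {K : ℝ}
    (hK : ‖vel (uR 0)‖ ^ 2 + ν * Δt * ‖grad (uR 0)‖ ^ 2 + ε * ‖pM 0‖ ^ 2
        + 4 * Δt / ν * ∑ n ∈ Finset.range N, negNorm (f (n + 1)) ^ 2 ≤ K) :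
    (∀ n ≤ N, ‖vel (uR n)‖ ^ 2 ≤ K) ∧
      ν * Δt * ∑ n ∈ Finset.range N, ‖grad (uR n)‖ ^ 2 ≤ K := by
  have H : ∀ n ≤ N, ‖vel (uR n)‖ ^ 2 + ε * ‖pM n‖ ^ 2
      + ν * Δt * ∑ k ∈ Finset.range n, ‖grad (uR (k + 1))‖ ^ 2
      ≤ ‖vel (uR 0)‖ ^ 2 + ε * ‖pM 0‖ ^ 2
        + Δt / ν * ∑ k ∈ Finset.range n, negNorm (f (k + 1)) ^ 2 := by
    intro n
    induction n with
    | zero => simp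
    | succ n ih =>
      intro hn
      have h1 := ih (by omega)
      have h2 := h.energy_step hL hν hε hΔ (n := n) (by omega)
      rw [Finset.sum_range_succ, Finset.sum_range_succ, mul_add, mul_add]
      linarith
  have hmono : ∀ n ≤ N, Δt / ν * ∑ k ∈ Finset.range n, negNorm (f (k + 1)) ^ 2
      ≤ 4 * Δt / ν * ∑ k ∈ Finset.range N, negNorm (f (k + 1)) ^ 2 := by
    intro n hn
    have hs : ∑ k ∈ Finset.range n, negNorm (f (k + 1)) ^ 2
        ≤ ∑ k ∈ Finset.range N, negNorm (f (k + 1)) ^ 2 :=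
      Finset.sum_le_sum_of_subset_of_nonneg (Finset.range_mono hn) fun _ _ _ => sq_nonneg _
    have h0 : 0 ≤ ∑ k ∈ Finset.range n, negNorm (f (k + 1)) ^ 2 :=
      Finset.sum_nonneg fun _ _ => sq_nonneg _
    gcongr
    linarith
  constructor
  · intro n hn
    have h1 := H n hn
    have h2 := hmono n hn
    have : 0 ≤ ν * Δt * ∑ k ∈ Finset.range n, ‖grad (uR (k + 1))‖ ^ 2 := by positivity
    have : 0 ≤ ε * ‖pM n‖ ^ 2 := by positivity
    have : 0 ≤ ν * Δt * ‖grad (uR 0)‖ ^ 2 := by positivity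
    linarith
  · have h1 := H N le_rfl
    have h2 := hmono N le_rfl
    -- The shift to the old level brings in `n = 0`, which the initial gradient term of the data
    -- pays for.
    have hs : ∑ n ∈ Finset.range N, ‖grad (uR n)‖ ^ 2
        ≤ ‖grad (uR 0)‖ ^ 2 + ∑ k ∈ Finset.range N, ‖grad (uR (k + 1))‖ ^ 2 := by
      have e := Finset.sum_range_succ' (fun n => ‖grad (uR n)‖ ^ 2) N
      rw [Finset.sum_range_succ] at e
      linarith [sq_nonneg ‖grad (uR N)‖]
    have : ν * Δt * ∑ n ∈ Finset.range N, ‖grad (uR n)‖ ^ 2 ≤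
        ν * Δt * (‖grad (uR 0)‖ ^ 2 + ∑ k ∈ Finset.range N, ‖grad (uR (k + 1))‖ ^ 2) := by gcongr
    have : 0 ≤ ε * ‖pM N‖ ^ 2 := by positivity
    linarith [sq_nonneg ‖vel (uR N)‖]

end IsACROM

/-! ### The error equation and its recursion -/

/-- The error equation, tested with the discrete errors themselves. -/
lemma error_identity {L ν ε D : ℝ} (hL : TriBound Ω L) (hD : D ≠ 0)
    {u u' uR uR' ξ ξ' η η' : X Ω} {p p' pM pM' π π' κ κ' : L2S Ω} {w g : L2V Ω}
    (hu : uR = ξ + (u - η)) (hu' : uR' = ξ' + (u' - η')) (hp : pM = π + (p - κ))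
    (hp' : pM' = π' + (p' - κ'))
    (hex : inner ℝ w (vel ξ') + skewForm u' u' ξ' + ν * inner ℝ (grad u') (grad ξ')
      - inner ℝ p' (divg ξ') = inner ℝ g (vel ξ'))
    (hrom : inner ℝ (D⁻¹ • (vel uR' - vel uR)) (vel ξ') + skewForm uR uR' ξ'
      + ν * inner ℝ (grad uR') (grad ξ') - inner ℝ pM' (divg ξ') = inner ℝ g (vel ξ'))
    (hpr : ε * inner ℝ (D⁻¹ • (pM' - pM)) π' + inner ℝ (divg uR') π' = 0)
    (hdiv : divg u' = 0) (hη : inner ℝ (vel η) (vel ξ') = 0)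
    (hη' : inner ℝ (vel η') (vel ξ') = 0) (hκ : inner ℝ κ π' = 0) (hκ' : inner ℝ κ' π' = 0) :
    inner ℝ (vel ξ' - vel ξ) (vel ξ') + ε * inner ℝ (π' - π) π' + D * ν * ‖grad ξ'‖ ^ 2
      = D * (-inner ℝ (D⁻¹ • (vel u' - vel u) - w) (vel ξ') + ν * inner ℝ (grad η') (grad ξ')
        - inner ℝ κ' (divg ξ') - skewForm ξ u' ξ' + skewForm η u' ξ' + skewForm (u' - u) u' ξ'
        + skewForm uR η' ξ' + inner ℝ (divg η') π') - ε * inner ℝ (p' - p) π' := by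
  -- The `ξ'` part of `u_R'` drops out by skew symmetry.
  have b1 : skewForm uR uR' ξ' = skewForm uR u' ξ' - skewForm uR η' ξ' := by
    have : uR' = (u' - η') - (0 - ξ') := by rw [hu']; abel
    rw [this, hL.skew_sub_mid, hL.skew_sub_mid, hL.skew_sub_mid, skewForm_self]
    have : skewForm uR 0 ξ' = 0 := by simpa using hL.skew_sub_mid uR 0 0 ξ'
    rw [this]; ring
  -- The advecting field is compared with `u'`, so that each difference is multiplied by the bounded
  -- `∇u'`.
  have b2 : skewForm uR u' ξ' = skewForm ξ u' ξ' - skewForm η u' ξ' - skewForm (u' - u) u' ξ'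
      + skewForm u' u' ξ' := by
    have : uR = ξ - η - (u' - u) - (0 - u') := by rw [hu]; abel
    have h0 : skewForm 0 u' ξ' = 0 := by simpa using hL.skew_sub_left 0 0 u' ξ'
    rw [this, hL.skew_sub_left, hL.skew_sub_left, hL.skew_sub_left, hL.skew_sub_left 0, h0]
    ring
  rw [b1, b2] at hrom
  rw [hu, hu', hp'] at hrom
  rw [hu', hp, hp'] at hpr
  simp only [map_add, map_sub, hdiv, inner_add_left, inner_sub_left, inner_smul_left,
    conj_trivial, hη, hη', hκ, hκ', real_inner_self_eq_norm_sq, inner_zero_left] at hrom hpr hex ⊢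
  rw [real_inner_comm π' (divg ξ')] at hpr
  rw [← hu] at hrom
  have hDD : D * D⁻¹ = 1 := mul_inv_cancel₀ hD
  linear_combination (-(‖vel ξ'‖ ^ 2 - inner ℝ (vel ξ) (vel ξ') + ε * (‖π'‖ ^ 2 - inner ℝ π π')
    + ε * (inner ℝ p' π' - inner ℝ p π'))) * hDD + D * (hrom - hex) + D * hpr

/-- The data term of one step of the error recursion, in terms of the norms `τ` of the truncation
error, `h`, `h'` of `∇η` at the old and the new time, `k'` of `κ` at the new time, `δ` of the
increment of `∇u`, and the product `ab` of the norms of `u_R` and `∇u_R` at the old time. -/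
def stepForcing (L K m α ν ε D c₁ P τ h h' k' δ ab : ℝ) : ℝ :=
  8 / ν * D * (L * τ) ^ 2 + 8 * ν * D * h' ^ 2 + 8 / ν * D * (m * k') ^ 2
    + 8 / ν * D * (L * √L * K * h) ^ 2 + 8 / ν * D * (L * √L * K * δ) ^ 2
    + 8 / ν * D * (L ^ 2 * ab * h' ^ 2) + (4 * D / c₁ + 1) * (α * m * h') ^ 2
    + ε * D * P ^ 2 * (4 * D + 1)

lemma young_mul {ν c g : ℝ} (hν : 0 < ν) : 2 * (c * g) ≤ ν / 8 * g ^ 2 + 8 / ν * c ^ 2 := by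
  have : ν / 8 * g ^ 2 + 8 / ν * c ^ 2 - 2 * (c * g) = (ν * g - 8 * c) ^ 2 / (8 * ν) := by
    field_simp; ring
  have h0 : 0 ≤ (ν * g - 8 * c) ^ 2 / (8 * ν) := by positivity
  linarith

/-- Absorption of the pressure terms, treated explicitly in time. -/
lemma pressure_absorb {ε D c₁ P A q r : ℝ} (hD : 0 < D) (hc₁ : 0 < c₁) (hε : c₁ * D ≤ ε) :
    2 * D * (A * (q + r)) + 2 * ε * (D * P * (q + r)) ≤
      ε / 2 * r ^ 2 + D * (1 / c₁ + 1) * (ε * q ^ 2) + (4 * D / c₁ + 1) * A ^ 2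
        + ε * D * P ^ 2 * (4 * D + 1) := by
  have hε0 : 0 < ε := (mul_pos hc₁ hD).trans_le hε
  have h1 : 2 * D * (A * q) ≤ D / c₁ * (ε * q ^ 2) + A ^ 2 := by
    -- The lower bound `ε ≥ c₁ D` lets the pressure energy control `D² q²` with a factor `D` to
    -- spare for Gronwall.
    have : D ^ 2 * q ^ 2 ≤ D / c₁ * (ε * q ^ 2) := by
      rw [div_mul_eq_mul_div, le_div_iff₀ hc₁]
      nlinarith [mul_nonneg hD.le (sq_nonneg q)]
    nlinarith [sq_nonneg (D * q - A)]
  have h2 : 2 * D * (A * r) ≤ ε / 4 * r ^ 2 + 4 * D / c₁ * A ^ 2 := by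
    have e1 : 2 * D * (A * r) ≤ c₁ * D / 4 * r ^ 2 + 4 * D / c₁ * A ^ 2 := by
      have : c₁ * D / 4 * r ^ 2 + 4 * D / c₁ * A ^ 2 - 2 * D * (A * r)
          = D * (c₁ * r - 4 * A) ^ 2 / (4 * c₁) := by field_simp; ring
      have h0 : 0 ≤ D * (c₁ * r - 4 * A) ^ 2 / (4 * c₁) := by positivity
      linarith
    nlinarith [sq_nonneg r]
  have h3 : 2 * ε * (D * P * q) ≤ D * (ε * q ^ 2) + ε * D * P ^ 2 := by
    have : 0 ≤ ε * D * (q - P) ^ 2 := by positivity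
    nlinarith
  have h4 : 2 * ε * (D * P * r) ≤ ε / 4 * r ^ 2 + ε * D * P ^ 2 * (4 * D) := by
    have : 0 ≤ ε * (r / 2 - 2 * (D * P)) ^ 2 := by positivity
    nlinarith
  have e : D * (1 / c₁ + 1) * (ε * q ^ 2) = D / c₁ * (ε * q ^ 2) + D * (ε * q ^ 2) := by ring
  rw [e]
  linarith

/-- One step of the error recursion. -/
lemma error_step {L K m α ν ε D c₁ P : ℝ} (hL : TriBound Ω L) (hν : 0 < ν) (hD : 0 < D)
    (hc₁ : 0 < c₁) (hε : c₁ * D ≤ ε) (hm : 0 ≤ m)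
    (hdivg : ∀ v : X Ω, ‖divg v‖ ≤ m * ‖grad v‖)
    {u u' uR ξ ξ' η η' : X Ω} {p p' π π' κ' : L2S Ω} {τ : L2V Ω}
    (hK : ‖grad u'‖ ≤ K) (hP : ‖p' - p‖ ≤ D * P)
    (hα : |inner ℝ (divg η') π'| ≤ |α| * (‖divg η'‖ * ‖π'‖))
    (hI : inner ℝ (vel ξ' - vel ξ) (vel ξ') + ε * inner ℝ (π' - π) π' + D * ν * ‖grad ξ'‖ ^ 2
      = D * (-inner ℝ τ (vel ξ') + ν * inner ℝ (grad η') (grad ξ')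
        - inner ℝ κ' (divg ξ') - skewForm ξ u' ξ' + skewForm η u' ξ' + skewForm (u' - u) u' ξ'
        + skewForm uR η' ξ' + inner ℝ (divg η') π') - ε * inner ℝ (p' - p) π') :
    (‖vel ξ'‖ ^ 2 + ε * ‖π'‖ ^ 2 + ν * D / 2 * ‖grad ξ'‖ ^ 2)
      + (‖vel ξ' - vel ξ‖ ^ 2 + ε / 2 * ‖π' - π‖ ^ 2 + ν * D / 2 * ‖grad ξ'‖ ^ 2)
      ≤ (1 + D * (32 * L ^ 4 * K ^ 4 / ν ^ 3 + 1 / c₁ + 1))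
          * (‖vel ξ‖ ^ 2 + ε * ‖π‖ ^ 2 + ν * D / 2 * ‖grad ξ‖ ^ 2)
        + stepForcing L K m α ν ε D c₁ P ‖τ‖ ‖grad η‖ ‖grad η'‖ ‖κ'‖ ‖grad (u' - u)‖
          (‖vel uR‖ * ‖grad uR‖) := by
  have hL0 := hL.nonneg
  have hK0 : 0 ≤ K := (norm_nonneg _).trans hK
  have hε0 : 0 < ε := (mul_pos hc₁ hD).trans_le hε
  have e1 := two_inner_sub_self (vel ξ') (vel ξ)
  have e2 := two_inner_sub_self π' π
  have hπ : ‖π'‖ ≤ ‖π‖ + ‖π' - π‖ := by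
    have := norm_add_le π (π' - π); rwa [add_sub_cancel] at this
  have t1 : -inner ℝ τ (vel ξ') ≤ L * ‖τ‖ * ‖grad ξ'‖ := by
    refine (neg_le_abs _).trans ((abs_real_inner_le_norm _ _).trans ?_)
    calc ‖τ‖ * ‖vel ξ'‖ ≤ ‖τ‖ * (L * ‖grad ξ'‖) := by gcongr; exact hL.poincare ξ'
      _ = _ := by ring
  have t2 : ν * inner ℝ (grad η') (grad ξ') ≤ ν * ‖grad η'‖ * ‖grad ξ'‖ := by
    rw [mul_assoc]; gcongr; exact real_inner_le_norm _ _
  have t3 : -inner ℝ κ' (divg ξ') ≤ m * ‖κ'‖ * ‖grad ξ'‖ := by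
    refine (neg_le_abs _).trans ((abs_real_inner_le_norm _ _).trans ?_)
    calc ‖κ'‖ * ‖divg ξ'‖ ≤ ‖κ'‖ * (m * ‖grad ξ'‖) := by gcongr; exact hdivg ξ'
      _ = _ := by ring
  have t4 : -skewForm ξ u' ξ' ≤ L * √(‖vel ξ‖ * ‖grad ξ‖) * K * ‖grad ξ'‖ := by
    refine (neg_le_abs _).trans ((hL.skew_le _ _ _).trans ?_)
    gcongr
  have t5 : skewForm η u' ξ' ≤ L * √L * K * ‖grad η‖ * ‖grad ξ'‖ := by
    refine (le_abs_self _).trans ((hL.skew_le_grad _ _ _).trans ?_)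
    calc L * √L * ‖grad η‖ * ‖grad u'‖ * ‖grad ξ'‖ ≤ L * √L * ‖grad η‖ * K * ‖grad ξ'‖ := by gcongr
      _ = _ := by ring
  have t6 : skewForm (u' - u) u' ξ' ≤ L * √L * K * ‖grad (u' - u)‖ * ‖grad ξ'‖ := by
    refine (le_abs_self _).trans ((hL.skew_le_grad _ _ _).trans ?_)
    calc L * √L * ‖grad (u' - u)‖ * ‖grad u'‖ * ‖grad ξ'‖
        ≤ L * √L * ‖grad (u' - u)‖ * K * ‖grad ξ'‖ := by gcongr
      _ = _ := by ring
  have t7 : skewForm uR η' ξ' ≤ L * √(‖vel uR‖ * ‖grad uR‖) * ‖grad η'‖ * ‖grad ξ'‖ :=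
    (le_abs_self _).trans (hL.skew_le _ _ _)
  have t8 : inner ℝ (divg η') π' ≤ |α| * m * ‖grad η'‖ * (‖π‖ + ‖π' - π‖) := by
    refine (le_abs_self _).trans (hα.trans ?_)
    calc |α| * (‖divg η'‖ * ‖π'‖) ≤ |α| * (m * ‖grad η'‖ * (‖π‖ + ‖π' - π‖)) := by
          gcongr; exact hdivg η'
      _ = _ := by ring
  have t9 : -inner ℝ (p' - p) π' ≤ D * P * (‖π‖ + ‖π' - π‖) := by
    refine (neg_le_abs _).trans ((abs_real_inner_le_norm _ _).trans ?_)
    have := (norm_nonneg _).trans hP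
    gcongr
  -- Second use of Young: the coefficient `ν/2` is exactly what the old energy offers after
  -- multiplication by `D`.
  have t4' : 8 / ν * (L * √(‖vel ξ‖ * ‖grad ξ‖) * K) ^ 2
      ≤ ν / 2 * ‖grad ξ‖ ^ 2 + 32 * L ^ 4 * K ^ 4 / ν ^ 3 * ‖vel ξ‖ ^ 2 := by
    rw [mul_pow, mul_pow, Real.sq_sqrt (by positivity)]
    have : ν / 2 * ‖grad ξ‖ ^ 2 + 32 * L ^ 4 * K ^ 4 / ν ^ 3 * ‖vel ξ‖ ^ 2
        - 8 / ν * (L ^ 2 * (‖vel ξ‖ * ‖grad ξ‖) * K ^ 2)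
        = (ν ^ 2 * ‖grad ξ‖ - 8 * L ^ 2 * K ^ 2 * ‖vel ξ‖) ^ 2 / (2 * ν ^ 3) := by
      field_simp; ring
    have h0 : 0 ≤ (ν ^ 2 * ‖grad ξ‖ - 8 * L ^ 2 * K ^ 2 * ‖vel ξ‖) ^ 2 / (2 * ν ^ 3) := by
      positivity
    linarith
  have y1 := young_mul (c := L * ‖τ‖) (g := ‖grad ξ'‖) hν
  have y2 := young_mul (c := ν * ‖grad η'‖) (g := ‖grad ξ'‖) hν
  have y3 := young_mul (c := m * ‖κ'‖) (g := ‖grad ξ'‖) hν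
  have y4 := young_mul (c := L * √(‖vel ξ‖ * ‖grad ξ‖) * K) (g := ‖grad ξ'‖) hν
  have y5 := young_mul (c := L * √L * K * ‖grad η‖) (g := ‖grad ξ'‖) hν
  have y6 := young_mul (c := L * √L * K * ‖grad (u' - u)‖) (g := ‖grad ξ'‖) hν
  have y7 := young_mul (c := L * √(‖vel uR‖ * ‖grad uR‖) * ‖grad η'‖) (g := ‖grad ξ'‖) hν
  have y2' : 8 / ν * (ν * ‖grad η'‖) ^ 2 = 8 * ν * ‖grad η'‖ ^ 2 := by field_simp
  have y7' : 8 / ν * (L * √(‖vel uR‖ * ‖grad uR‖) * ‖grad η'‖) ^ 2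
      = 8 / ν * (L ^ 2 * (‖vel uR‖ * ‖grad uR‖) * ‖grad η'‖ ^ 2) := by
    rw [mul_pow, mul_pow, Real.sq_sqrt (by positivity)]
  -- Seven terms take `ν/8 ‖∇ξ'‖²` each, rounded up to `ν`. Of the `2 D ν ‖∇ξ'‖²` available, `D ν
  -- ‖∇ξ'‖²` remains: half enters the new energy, half the dissipation.
  have hv : 2 * (-inner ℝ τ (vel ξ') + ν * inner ℝ (grad η') (grad ξ')
        - inner ℝ κ' (divg ξ') - skewForm ξ u' ξ' + skewForm η u' ξ' + skewForm (u' - u) u' ξ'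
        + skewForm uR η' ξ') ≤ ν * ‖grad ξ'‖ ^ 2 + ν / 2 * ‖grad ξ‖ ^ 2
        + 32 * L ^ 4 * K ^ 4 / ν ^ 3 * ‖vel ξ‖ ^ 2
        + (8 / ν * (L * ‖τ‖) ^ 2 + 8 * ν * ‖grad η'‖ ^ 2 + 8 / ν * (m * ‖κ'‖) ^ 2
          + 8 / ν * (L * √L * K * ‖grad η‖) ^ 2 + 8 / ν * (L * √L * K * ‖grad (u' - u)‖) ^ 2
          + 8 / ν * (L ^ 2 * (‖vel uR‖ * ‖grad uR‖) * ‖grad η'‖ ^ 2)) := by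
    have : 0 ≤ ν * ‖grad ξ'‖ ^ 2 := by positivity
    linarith
  have hv' := mul_le_mul_of_nonneg_left hv hD.le
  have hpress := pressure_absorb (P := P) (A := |α| * m * ‖grad η'‖) (q := ‖π‖)
    (r := ‖π' - π‖) hD hc₁ hε
  have hA : (|α| * m * ‖grad η'‖) ^ 2 = (α * m * ‖grad η'‖) ^ 2 := by
    rw [mul_pow, mul_pow, sq_abs, mul_pow, mul_pow]
  rw [hA] at hpress
  have t8' := mul_le_mul_of_nonneg_left t8 (by positivity : 0 ≤ 2 * D)
  have t9' := mul_le_mul_of_nonneg_left t9 (by positivity : 0 ≤ 2 * ε)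
  have e2' : ε * (2 * inner ℝ (π' - π) π') = ε * ‖π'‖ ^ 2 - ε * ‖π‖ ^ 2 + ε * ‖π' - π‖ ^ 2 := by
    rw [e2]; ring
  -- Nonnegative terms added so that one growth rate multiplies the whole old energy.
  have drop : 0 ≤ D * (32 * L ^ 4 * K ^ 4 / ν ^ 3) * (ε * ‖π‖ ^ 2)
      + D * (1 / c₁ + 1) * ‖vel ξ‖ ^ 2
      + D * (32 * L ^ 4 * K ^ 4 / ν ^ 3 + 1 / c₁ + 1) * (ν * D / 2 * ‖grad ξ‖ ^ 2) := by
    positivity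
  rw [stepForcing]
  linarith

/-! ### Summation in time and the data terms -/

lemma sum_shift_le (g : ℕ → ℝ) (hg : ∀ n, 0 ≤ g n) (N : ℕ) :
    ∑ n ∈ Finset.range N, g (n + 1) ≤ ∑ n ∈ Finset.range (N + 1), g n := by
  rw [Finset.sum_range_succ']
  linarith [hg 0]

lemma sum_init_le (g : ℕ → ℝ) (hg : ∀ n, 0 ≤ g n) (N : ℕ) :
    ∑ n ∈ Finset.range N, g n ≤ ∑ n ∈ Finset.range (N + 1), g n := by
  rw [Finset.sum_range_succ]
  linarith [hg N]

/-- The convection term with the reduced velocity, summed over time. -/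
lemma sum_convection_le {ν D K : ℝ} (hν : 0 < ν) (hD : 0 < D) (hK : 0 ≤ K) {N : ℕ}
    {a b h : ℕ → ℝ} (hb0 : ∀ n, 0 ≤ b n)
    (ha : ∀ n < N, a n ^ 2 ≤ K) (hb : ν * D * ∑ n ∈ Finset.range N, b n ^ 2 ≤ K) :
    1 / ν * D * ∑ n ∈ Finset.range N, a n * b n * h (n + 1) ^ 2 ≤
      K * (D ^ (1 / 2 : ℝ) / ν ^ (3 / 2 : ℝ)
        * (∑ n ∈ Finset.range N, h (n + 1) ^ 4) ^ (1 / 2 : ℝ)) := by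
  have h1 : ∑ n ∈ Finset.range N, a n * b n * h (n + 1) ^ 2
      ≤ √K * ∑ n ∈ Finset.range N, b n * h (n + 1) ^ 2 := by
    rw [Finset.mul_sum]
    refine Finset.sum_le_sum fun n hn => ?_
    have : a n ≤ √K := Real.le_sqrt_of_sq_le (ha n (Finset.mem_range.mp hn))
    have := hb0 n
    rw [← mul_assoc]
    gcongr
  have h2 : ∑ n ∈ Finset.range N, b n * h (n + 1) ^ 2
      ≤ √(∑ n ∈ Finset.range N, b n ^ 2) * √(∑ n ∈ Finset.range N, h (n + 1) ^ 4) := by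
    have := Real.sum_mul_le_sqrt_mul_sqrt (Finset.range N) b (fun n => h (n + 1) ^ 2)
    simpa only [← pow_mul] using this
  -- The stability bound on the gradients; its `(ν D)^{-1/2}` turns `D / ν` into `D^{1/2} /
  -- ν^{3/2}`.
  have h3 : √(∑ n ∈ Finset.range N, b n ^ 2) ≤ √(K / (ν * D)) := by
    refine Real.sqrt_le_sqrt ?_
    rw [le_div_iff₀ (by positivity)]
    linarith
  have hν3 : ν ^ (3 / 2 : ℝ) = ν * √ν := by
    rw [Real.sqrt_eq_rpow, show (3 / 2 : ℝ) = 1 + 1 / 2 by norm_num, Real.rpow_add hν,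
      Real.rpow_one]
  rw [← Real.sqrt_eq_rpow, ← Real.sqrt_eq_rpow, hν3]
  set Q := √(∑ n ∈ Finset.range N, h (n + 1) ^ 4)
  calc 1 / ν * D * ∑ n ∈ Finset.range N, a n * b n * h (n + 1) ^ 2
      ≤ 1 / ν * D * (√K * (√(K / (ν * D)) * Q)) := by
        gcongr
        exact h1.trans (by gcongr; exact h2.trans (by gcongr))
    _ = _ := by
        rw [Real.sqrt_div hK, Real.sqrt_mul hν.le]
        have hsD : 0 < √D := Real.sqrt_pos.mpr hD
        have hsν : 0 < √ν := Real.sqrt_pos.mpr hν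
        field_simp
        rw [Real.sq_sqrt hD.le, Real.sq_sqrt hK]
        ring

lemma sum_stepForcing_le {L K m α ν ε D c₁ P I J : ℝ} (hL : 0 ≤ L) (hν : 0 < ν) (hD : 0 < D)
    (hc₁ : 0 < c₁) (hK : 0 ≤ K) {N : ℕ} {τ h k δ a b : ℕ → ℝ}
    (hτ : ∑ n ∈ Finset.range N, τ n ^ 2 ≤ D * I) (hδ : ∑ n ∈ Finset.range N, δ n ^ 2 ≤ D * J)
    (hb0 : ∀ n, 0 ≤ b n) (ha : ∀ n < N, a n ^ 2 ≤ K)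
    (hb : ν * D * ∑ n ∈ Finset.range N, b n ^ 2 ≤ K) :
    ∑ n ∈ Finset.range N, stepForcing L K m α ν ε D c₁ P (τ n) (h n) (h (n + 1)) (k (n + 1)) (δ n)
        (a n * b n) ≤
      8 * L ^ 2 * (D ^ 2 / ν * I) + 8 * ν * (D * ∑ n ∈ Finset.range (N + 1), h n ^ 2)
        + 8 * m ^ 2 * (1 / ν * (D * ∑ n ∈ Finset.range (N + 1), k n ^ 2))
        + 8 * L ^ 3 * K ^ 2 * (1 / ν * (D * ∑ n ∈ Finset.range (N + 1), h n ^ 2))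
        + 8 * L ^ 3 * K ^ 2 * (D ^ 2 / ν * J)
        + 8 * L ^ 2 * K * (D ^ (1 / 2 : ℝ) / ν ^ (3 / 2 : ℝ)
          * (∑ n ∈ Finset.range N, h (n + 1) ^ 4) ^ (1 / 2 : ℝ))
        + (4 / c₁ * α ^ 2 + α ^ 2 * D⁻¹) * m ^ 2 * (D * ∑ n ∈ Finset.range (N + 1), h n ^ 2)
        + ε * (D * N) * (4 * D + 1) * P ^ 2 := by
  have hh' := sum_shift_le (fun n => h n ^ 2) (fun n => sq_nonneg _) N
  have hh := sum_init_le (fun n => h n ^ 2) (fun n => sq_nonneg _) N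
  have hk := sum_shift_le (fun n => k n ^ 2) (fun n => sq_nonneg _) N
  have hconv := sum_convection_le (h := h) hν hD hK hb0 ha hb
  set H := ∑ n ∈ Finset.range (N + 1), h n ^ 2
  have hs : (L * √L) ^ 2 = L ^ 3 := by rw [mul_pow, Real.sq_sqrt hL]; ring
  have e : ∑ n ∈ Finset.range N, stepForcing L K m α ν ε D c₁ P (τ n) (h n) (h (n + 1)) (k (n + 1))
      (δ n) (a n * b n) =
      8 / ν * D * L ^ 2 * (∑ n ∈ Finset.range N, τ n ^ 2)
      + 8 * ν * D * (∑ n ∈ Finset.range N, h (n + 1) ^ 2)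
      + 8 / ν * D * m ^ 2 * (∑ n ∈ Finset.range N, k (n + 1) ^ 2)
      + 8 / ν * D * L ^ 3 * K ^ 2 * (∑ n ∈ Finset.range N, h n ^ 2)
      + 8 / ν * D * L ^ 3 * K ^ 2 * (∑ n ∈ Finset.range N, δ n ^ 2)
      + 8 * L ^ 2 * (1 / ν * D * ∑ n ∈ Finset.range N, a n * b n * h (n + 1) ^ 2)
      + (4 * D / c₁ + 1) * α ^ 2 * m ^ 2 * (∑ n ∈ Finset.range N, h (n + 1) ^ 2)
      + N * (ε * D * P ^ 2 * (4 * D + 1)) := by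
    simp only [Finset.mul_sum]
    rw [← nsmul_eq_mul N, ← Finset.card_range N, ← Finset.sum_const, Finset.card_range]
    simp only [← Finset.sum_add_distrib]
    refine Finset.sum_congr rfl fun n _ => ?_
    rw [stepForcing, ← hs]
    ring
  rw [e]
  have i1 : 8 / ν * D * L ^ 2 * (∑ n ∈ Finset.range N, τ n ^ 2) ≤ 8 * L ^ 2 * (D ^ 2 / ν * I) := by
    calc _ ≤ 8 / ν * D * L ^ 2 * (D * I) := by gcongr
      _ = _ := by ring
  have i2 : 8 * ν * D * (∑ n ∈ Finset.range N, h (n + 1) ^ 2) ≤ 8 * ν * (D * H) := by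
    calc _ ≤ 8 * ν * D * H := by gcongr
      _ = _ := by ring
  have i3 : 8 / ν * D * m ^ 2 * (∑ n ∈ Finset.range N, k (n + 1) ^ 2)
      ≤ 8 * m ^ 2 * (1 / ν * (D * ∑ n ∈ Finset.range (N + 1), k n ^ 2)) := by
    calc _ ≤ 8 / ν * D * m ^ 2 * (∑ n ∈ Finset.range (N + 1), k n ^ 2) := by gcongr
      _ = _ := by ring
  have i4 : 8 / ν * D * L ^ 3 * K ^ 2 * (∑ n ∈ Finset.range N, h n ^ 2)
      ≤ 8 * L ^ 3 * K ^ 2 * (1 / ν * (D * H)) := by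
    calc _ ≤ 8 / ν * D * L ^ 3 * K ^ 2 * H := by gcongr
      _ = _ := by ring
  have i5 : 8 / ν * D * L ^ 3 * K ^ 2 * (∑ n ∈ Finset.range N, δ n ^ 2)
      ≤ 8 * L ^ 3 * K ^ 2 * (D ^ 2 / ν * J) := by
    calc _ ≤ 8 / ν * D * L ^ 3 * K ^ 2 * (D * J) := by gcongr
      _ = _ := by ring
  have i6 := mul_le_mul_of_nonneg_left hconv (by positivity : 0 ≤ 8 * L ^ 2)
  have i7 : (4 * D / c₁ + 1) * α ^ 2 * m ^ 2 * (∑ n ∈ Finset.range N, h (n + 1) ^ 2)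
      ≤ (4 / c₁ * α ^ 2 + α ^ 2 * D⁻¹) * m ^ 2 * (D * H) := by
    calc _ ≤ (4 * D / c₁ + 1) * α ^ 2 * m ^ 2 * H := by gcongr
      _ = _ := by field_simp
  linarith

/-- The data terms of the error estimate absorb the summed forcing. -/
lemma data_absorb {L K m α ν ν₀ ε D c₁ c₂ P T I J G₂ K₂ Q A N : ℝ} (hL : 0 ≤ L) (hν : 0 < ν)
    (hνν : ν ≤ ν₀) (hD : 0 < D) (hDT : D ≤ T) (hN : D * N = T) (hc₁ : 0 < c₁)
    (hε0 : 0 ≤ ε) (hε : ε ≤ c₂ * D) (hK : 0 ≤ K) (hα : α ^ 2 ≤ 1) (hI : 0 ≤ I) (hJ : 0 ≤ J)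
    (hG : 0 ≤ G₂) (hK₂ : 0 ≤ K₂) (hQ : 0 ≤ Q)
    (hA : A = 8 * L ^ 2 + 8 * ν₀ ^ 2 + 8 * m ^ 2 + 8 * L ^ 3 * K ^ 2 + 8 * L ^ 2 * K
      + 4 / c₁ * ν₀ * m ^ 2 + 9 * c₂) :
    8 * L ^ 2 * (D ^ 2 / ν * I) + 8 * ν * G₂ + 8 * m ^ 2 * (1 / ν * K₂)
        + 8 * L ^ 3 * K ^ 2 * (1 / ν * G₂) + 8 * L ^ 3 * K ^ 2 * (D ^ 2 / ν * J)
        + 8 * L ^ 2 * K * Q + (4 / c₁ * α ^ 2 + α ^ 2 * D⁻¹) * m ^ 2 * G₂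
        + ε * (D * N) * (4 * D + 1) * P ^ 2
      ≤ A * Real.exp T * ((1 / ν + α ^ 2 * D⁻¹) * G₂ + 1 / ν * K₂ + D ^ 2 / ν * I
        + D ^ 2 / ν * J + Q + D * P ^ 2) := by
  have hT : 0 < T := hD.trans_le hDT
  have hν₀ : 0 < ν₀ := hν.trans_le hνν
  have hc₂ : 0 ≤ c₂ := by
    by_contra hneg
    nlinarith
  have hexp := Real.quadratic_le_exp_of_nonneg hT.le
  have hE1 : 1 ≤ Real.exp T := Real.one_le_exp hT.le
  have n1 : 0 ≤ D ^ 2 / ν * I := by positivity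
  have n2 : 0 ≤ D ^ 2 / ν * J := by positivity
  have n3 : 0 ≤ 1 / ν * K₂ := by positivity
  have n4 : 0 ≤ 1 / ν * G₂ := by positivity
  have n5 : 0 ≤ α ^ 2 * D⁻¹ * G₂ := by positivity
  have n6 : 0 ≤ D * P ^ 2 := by positivity
  have i2 : 8 * ν * G₂ ≤ 8 * ν₀ ^ 2 * (1 / ν * G₂) := by
    have : ν ≤ ν₀ ^ 2 * (1 / ν) := by
      rw [mul_one_div, le_div_iff₀ hν]
      nlinarith
    nlinarith
  have i7 : 4 / c₁ * α ^ 2 * m ^ 2 * G₂ ≤ 4 / c₁ * ν₀ * m ^ 2 * (1 / ν * G₂) := by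
    have : α ^ 2 ≤ ν₀ * (1 / ν) := by
      refine hα.trans ?_
      rw [mul_one_div, le_div_iff₀ hν]
      linarith
    calc 4 / c₁ * α ^ 2 * m ^ 2 * G₂ ≤ 4 / c₁ * (ν₀ * (1 / ν)) * m ^ 2 * G₂ := by gcongr
      _ = _ := by ring
  have i8 : ε * (D * N) * (4 * D + 1) * P ^ 2 ≤ 9 * c₂ * Real.exp T * (D * P ^ 2) := by
    rw [hN]
    calc ε * T * (4 * D + 1) * P ^ 2 ≤ c₂ * D * T * (4 * T + 1) * P ^ 2 := by gcongr
      _ = c₂ * (T * (4 * T + 1)) * (D * P ^ 2) := by ring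
      _ ≤ c₂ * (9 * Real.exp T) * (D * P ^ 2) := by
          -- From `1 + T + T²/2 ≤ exp T`, used eight times for `4 T²` and once for `T`.
          have h9 : T * (4 * T + 1) ≤ 9 * Real.exp T := by linarith [sq_nonneg T]
          exact mul_le_mul_of_nonneg_right (mul_le_mul_of_nonneg_left h9 hc₂) n6
      _ = _ := by ring
  have hA8 : 9 * c₂ ≤ A := by rw [hA]; linarith [show 0 ≤ 8 * L ^ 2 + 8 * ν₀ ^ 2 + 8 * m ^ 2
    + 8 * L ^ 3 * K ^ 2 + 8 * L ^ 2 * K + 4 / c₁ * ν₀ * m ^ 2 by positivity]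
  have hA0 : 0 ≤ A := by linarith
  set B := A - 9 * c₂ with hB
  have hB' : B = 8 * L ^ 2 + 8 * ν₀ ^ 2 + 8 * m ^ 2 + 8 * L ^ 3 * K ^ 2 + 8 * L ^ 2 * K
      + 4 / c₁ * ν₀ * m ^ 2 := by rw [hB, hA]; ring
  have p1 : 0 ≤ 8 * L ^ 2 := by positivity
  have p2 : 0 ≤ 8 * ν₀ ^ 2 := by positivity
  have p3 : 0 ≤ 8 * m ^ 2 := by positivity
  have p4 : 0 ≤ 8 * L ^ 3 * K ^ 2 := by positivity
  have p5 : 0 ≤ 8 * L ^ 2 * K := by positivity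
  have p6 : 0 ≤ 4 / c₁ * ν₀ * m ^ 2 := by positivity
  have j1 : 8 * L ^ 2 * (D ^ 2 / ν * I) ≤ B * (D ^ 2 / ν * I) := by gcongr; linarith
  have j2 : 8 * L ^ 3 * K ^ 2 * (D ^ 2 / ν * J) ≤ B * (D ^ 2 / ν * J) := by gcongr; linarith
  have j3 : 8 * m ^ 2 * (1 / ν * K₂) ≤ B * (1 / ν * K₂) := by gcongr; linarith
  have j4 : (8 * ν₀ ^ 2 + 8 * L ^ 3 * K ^ 2 + 4 / c₁ * ν₀ * m ^ 2) * (1 / ν * G₂)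
      ≤ B * (1 / ν * G₂) := by gcongr; linarith
  have j5 : m ^ 2 * (α ^ 2 * D⁻¹ * G₂) ≤ B * (α ^ 2 * D⁻¹ * G₂) := by
    gcongr
    linarith [sq_nonneg m]
  have j6 : 8 * L ^ 2 * K * Q ≤ B * Q := by gcongr; linarith
  set R := (1 / ν + α ^ 2 * D⁻¹) * G₂ + 1 / ν * K₂ + D ^ 2 / ν * I + D ^ 2 / ν * J + Q with hR
  have hR0 : 0 ≤ R := by rw [hR, add_mul]; linarith
  have hmain : 8 * L ^ 2 * (D ^ 2 / ν * I) + 8 * ν * G₂ + 8 * m ^ 2 * (1 / ν * K₂)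
        + 8 * L ^ 3 * K ^ 2 * (1 / ν * G₂) + 8 * L ^ 3 * K ^ 2 * (D ^ 2 / ν * J)
        + 8 * L ^ 2 * K * Q + (4 / c₁ * α ^ 2 + α ^ 2 * D⁻¹) * m ^ 2 * G₂ ≤ B * R := by
    have eR : B * R = B * (1 / ν * G₂) + B * (α ^ 2 * D⁻¹ * G₂) + B * (1 / ν * K₂)
      + B * (D ^ 2 / ν * I) + B * (D ^ 2 / ν * J) + B * Q := by rw [hR]; ring
    rw [eR]
    linarith
  have hBR : B * R ≤ A * Real.exp T * R := by
    gcongr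
    calc B ≤ A := by linarith
      _ ≤ A * Real.exp T := le_mul_of_one_le_right hA0 hE1
  have hlast : 9 * c₂ * Real.exp T * (D * P ^ 2) ≤ A * Real.exp T * (D * P ^ 2) := by gcongr
  have eF : A * Real.exp T * (R + D * P ^ 2) = A * Real.exp T * R + A * Real.exp T * (D * P ^ 2) := by
    ring
  rw [eF]
  linarith

/-! ### Splitting the total error -/

lemma norm_sub_sq_of_inner_eq_zero {H : Type*} [NormedAddCommGroup H] [InnerProductSpace ℝ H]
    {x y : H} (h : inner ℝ x y = 0) : ‖x - y‖ ^ 2 = ‖x‖ ^ 2 + ‖y‖ ^ 2 := by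
  rw [norm_sub_sq_real, h]; ring

lemma norm_sub_sq_le_two {H : Type*} [NormedAddCommGroup H] [InnerProductSpace ℝ H] (x y : H) :
    ‖x - y‖ ^ 2 ≤ ‖x‖ ^ 2 + (‖x‖ ^ 2 + 2 * ‖y‖ ^ 2) := by
  have := parallelogram_law_with_norm ℝ x y
  nlinarith [sq_nonneg ‖x + y‖]

/-- The energy of the total error, split by orthogonality into the projection error and the
discrete error. -/
lemma errEnergy_le {ν ε Δt : ℝ} (hν : 0 ≤ ν) (hε : 0 ≤ ε) (hΔ : 0 ≤ Δt) {N : ℕ} {η ξ e : ℕ → X Ω}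
    {κ π r : ℕ → L2S Ω} (he : ∀ n, e n = η n - ξ n) (hr : ∀ n, r n = κ n - π n)
    (hoN : inner ℝ (vel (η N)) (vel (ξ N)) = 0) (hqN : inner ℝ (κ N) (π N) = 0)
    (ho : ∀ n < N, inner ℝ (vel (η (n + 1)) - vel (η n)) (vel (ξ (n + 1)) - vel (ξ n)) = 0)
    (hq : ∀ n < N, inner ℝ (κ (n + 1) - κ n) (π (n + 1) - π n) = 0) :
    errEnergy ν ε Δt N e r ≤ errEnergy ν ε Δt N η κ
      + 2 * ((‖vel (ξ N)‖ ^ 2 + ε * ‖π N‖ ^ 2 + ν * Δt / 2 * ‖grad (ξ N)‖ ^ 2)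
        + ∑ n ∈ Finset.range N, (‖vel (ξ (n + 1)) - vel (ξ n)‖ ^ 2 + ε / 2 * ‖π (n + 1) - π n‖ ^ 2
          + ν * Δt / 2 * ‖grad (ξ (n + 1))‖ ^ 2))
      + Δt * ν * ‖grad (ξ 0)‖ ^ 2 + ν * discL2sq Δt N (fun n => grad (η n)) := by
  have v1 : ‖vel (e N)‖ ^ 2 = ‖vel (η N)‖ ^ 2 + ‖vel (ξ N)‖ ^ 2 := by
    rw [he, map_sub, norm_sub_sq_of_inner_eq_zero hoN]
  have q1 : ‖r N‖ ^ 2 = ‖κ N‖ ^ 2 + ‖π N‖ ^ 2 := by rw [hr, norm_sub_sq_of_inner_eq_zero hqN]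
  -- One copy of `‖∇η‖²` is kept apart for the energy of `η`, which must keep coefficient one.
  have g1 : ∀ n, ‖grad (e n)‖ ^ 2 ≤ ‖grad (η n)‖ ^ 2 + (‖grad (η n)‖ ^ 2 + 2 * ‖grad (ξ n)‖ ^ 2) := by
    intro n
    rw [he, map_sub]
    exact norm_sub_sq_le_two _ _
  have s1 : ∑ n ∈ Finset.range N, (‖vel (e (n + 1)) - vel (e n)‖ ^ 2
      + ε / 2 * ‖r (n + 1) - r n‖ ^ 2)
      = ∑ n ∈ Finset.range N, (‖vel (η (n + 1)) - vel (η n)‖ ^ 2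
        + ε / 2 * ‖κ (n + 1) - κ n‖ ^ 2)
      + ∑ n ∈ Finset.range N, (‖vel (ξ (n + 1)) - vel (ξ n)‖ ^ 2
        + ε / 2 * ‖π (n + 1) - π n‖ ^ 2) := by
    rw [← Finset.sum_add_distrib]
    refine Finset.sum_congr rfl fun n hn => ?_
    have hn' := Finset.mem_range.mp hn
    rw [he, he, hr, hr, map_sub, map_sub, sub_sub_sub_comm, norm_sub_sq_of_inner_eq_zero (ho n hn'), sub_sub_sub_comm,
      norm_sub_sq_of_inner_eq_zero (hq n hn')]
    ring
  have s2 : ∑ n ∈ Finset.range (N + 1), ‖grad (e n)‖ ^ 2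
      ≤ ∑ n ∈ Finset.range (N + 1), ‖grad (η n)‖ ^ 2
        + (∑ n ∈ Finset.range (N + 1), ‖grad (η n)‖ ^ 2
          + 2 * (∑ n ∈ Finset.range N, ‖grad (ξ (n + 1))‖ ^ 2 + ‖grad (ξ 0)‖ ^ 2)) := by
    rw [← Finset.sum_range_succ' (fun n => ‖grad (ξ n)‖ ^ 2), Finset.mul_sum,
      ← Finset.sum_add_distrib, ← Finset.sum_add_distrib]
    exact Finset.sum_le_sum fun n _ => g1 n
  have s3 : ‖grad (η N)‖ ^ 2 ≤ ∑ n ∈ Finset.range (N + 1), ‖grad (η n)‖ ^ 2 :=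
     Finset.single_le_sum (f := fun n => ‖grad (η n)‖ ^ 2) (fun _ _ => sq_nonneg _)
      (Finset.mem_range.mpr N.lt_succ_self)
  simp only [errEnergy, discL2sq]
  rw [v1, q1, s1]
  simp only [Finset.sum_add_distrib, ← Finset.mul_sum]
  have m1 := mul_le_mul_of_nonneg_left (g1 N) (by positivity : 0 ≤ ν * Δt / 2)
  have m2 := mul_le_mul_of_nonneg_left s2 (by positivity : 0 ≤ ν / 2 * Δt)
  have m3 := mul_le_mul_of_nonneg_left s3 (by positivity : 0 ≤ ν * Δt / 2)
  have p1 : 0 ≤ ‖vel (ξ N)‖ ^ 2 := sq_nonneg _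
  have p2 : 0 ≤ ε * ‖π N‖ ^ 2 := mul_nonneg hε (sq_nonneg _)
  have p3 : 0 ≤ ∑ n ∈ Finset.range N, ‖vel (ξ (n + 1)) - vel (ξ n)‖ ^ 2 :=
    Finset.sum_nonneg fun _ _ => sq_nonneg _
  have p4 : 0 ≤ ε / 2 * ∑ n ∈ Finset.range N, ‖π (n + 1) - π n‖ ^ 2 :=
    mul_nonneg (by linarith) (Finset.sum_nonneg fun _ _ => sq_nonneg _)
  linarith

/-! ### Projections, principal angle and final constants -/

lemma velProj_mem {R : ℕ} (φ : Fin R → X Ω) (v : X Ω) :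
    velProj φ v ∈ Submodule.span ℝ (range φ) :=
  Submodule.sum_mem _ fun i _ => Submodule.smul_mem _ _ (Submodule.subset_span ⟨i, rfl⟩)

lemma presProj_mem {M : ℕ} (ψ : Fin M → L2S Ω) (q : L2S Ω) :
    presProj ψ q ∈ Submodule.span ℝ (range ψ) :=
  Submodule.sum_mem _ fun i _ => Submodule.smul_mem _ _ (Submodule.subset_span ⟨i, rfl⟩)

lemma divg_velProj_mem {R : ℕ} (φ : Fin R → X Ω) (v : X Ω) :
    divg (velProj φ v) ∈ Submodule.span ℝ (range fun i => divg (φ i)) := by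
  rw [velProj, map_sum]
  refine Submodule.sum_mem _ fun i _ => ?_
  rw [map_smul]
  exact Submodule.smul_mem _ _ (Submodule.subset_span ⟨i, rfl⟩)

/-- The pairing of the divergence of the projection error of a divergence-free field with the
reduced pressure space is controlled by the first principal angle. -/
lemma abs_inner_divg_le_angleCos {R M : ℕ} (φ : Fin R → X Ω) (ψ : Fin M → L2S Ω) {u : X Ω}
    (hu : divg u = 0) {q : L2S Ω} (hq : q ∈ Submodule.span ℝ (range ψ)) :
    |inner ℝ (divg (u - velProj φ u)) q|
      ≤ |angleCos φ ψ| * (‖divg (u - velProj φ u)‖ * ‖q‖) := by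
  -- Since `∇·u = 0`, the divergence of the projection error is `-∇·P_R u`.
  have hmem : divg (u - velProj φ u) ∈ Submodule.span ℝ (range fun i => divg (φ i)) := by
    rw [map_sub, hu, zero_sub]
    exact Submodule.neg_mem _ (divg_velProj_mem φ u)
  refine (abs_inner_le_cos_firstPrincipalAngle hmem hq).trans ?_
  gcongr
  exact le_abs_self _

lemma sum_intervals {g : ℝ → ℝ} {T Δt : ℝ} {N : ℕ} (hN : Δt * N = T) (hΔ : 0 ≤ Δt)
    (hg : ∀ a b, 0 ≤ a → a ≤ b → b ≤ T → IntervalIntegrable g volume a b) :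
    ∑ n ∈ Finset.range N, ∫ s in (n * Δt)..((n + 1 : ℕ) * Δt), g s = ∫ s in (0 : ℝ)..T, g s := by
  have h := intervalIntegral.sum_integral_adjacent_intervals (μ := volume) (f := g)
    (a := fun n : ℕ => (n : ℝ) * Δt) (n := N) (fun k hk => by
      refine hg _ _ (by positivity) (by gcongr; simp) ?_
      rw [← hN, mul_comm Δt]
      gcongr
      exact hk)
  rw [h, Nat.cast_zero, zero_mul, mul_comm, hN]

/-- Since `1 ≤ ν₀³ / ν³`, the `ν`-independent part of the rate, and the extra `exp T` from the data
terms, fit into one exponent proportional to `T / ν³`. -/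
lemma exp_rate_le {a c ν ν₀ T : ℝ} (hν : 0 < ν) (hνν : ν ≤ ν₀) (hc : 0 ≤ c) (hT : 0 ≤ T) :
    (a / ν ^ 3 + c) * T + T ≤ (a + (c + 1) * ν₀ ^ 3) * T / ν ^ 3 := by
  have h1 : 1 ≤ ν₀ ^ 3 / ν ^ 3 := by
    rw [le_div_iff₀ (by positivity), one_mul]
    gcongr
  calc (a / ν ^ 3 + c) * T + T = a * T / ν ^ 3 + (c + 1) * T * 1 := by ring
    _ ≤ a * T / ν ^ 3 + (c + 1) * T * (ν₀ ^ 3 / ν ^ 3) := by gcongr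
    _ = _ := by ring

/-- In the constant, `2 (A + 1)` pays for the discrete error, `1` for the initial gradient `r₃`, and
`v` for the extra projection gradient `V`. -/
lemma conclude_from_gronwall {E E₀ Z S₀ Fs A W R r₁ r₂ r₃ V v a T ρ : ℝ} (hA : 0 ≤ A)
    (hv : 0 ≤ v) (hW : 0 ≤ W) (hr₁ : 0 ≤ r₁) (hr₂ : 0 ≤ r₂) (hr₃ : 0 ≤ r₃) (ha : 0 ≤ a)
    (hT : 0 ≤ T) (hsplit : E ≤ E₀ + 2 * Z + r₃ + V) (hgron : Z ≤ Real.exp a * (S₀ + Fs))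
    (hF : Fs ≤ A * Real.exp T * W) (hS : S₀ ≤ r₁ + r₂ + r₃) (hρ : a + T ≤ ρ)
    (hV : V ≤ v * W) (hR : r₁ + r₂ + r₃ + W ≤ R) :
    E ≤ E₀ + (2 * (A + 1) + 1 + v) * Real.exp ρ * R := by
  have hR0 : 0 ≤ R := by linarith
  have hE : 1 ≤ Real.exp T := Real.one_le_exp hT
  have hEρ : 1 ≤ Real.exp ρ := Real.one_le_exp (by linarith)
  have hZ : Z ≤ (A + 1) * (Real.exp ρ * R) := by
    calc Z ≤ Real.exp a * (S₀ + Fs) := hgron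
      _ ≤ Real.exp a * (Real.exp T * R + A * Real.exp T * R) := by
          gcongr
          · calc S₀ ≤ R := by linarith
              _ ≤ Real.exp T * R := le_mul_of_one_le_left hR0 hE
          · refine hF.trans ?_
            gcongr
            linarith
      _ = (A + 1) * (Real.exp (a + T) * R) := by rw [Real.exp_add]; ring
      _ ≤ _ := by gcongr
  have hRρ : R ≤ Real.exp ρ * R := le_mul_of_one_le_left hR0 hEρ
  have hVρ : V ≤ v * (Real.exp ρ * R) := hV.trans (by gcongr; linarith)
  have e : (2 * (A + 1) + 1 + v) * Real.exp ρ * R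
      = 2 * ((A + 1) * (Real.exp ρ * R)) + Real.exp ρ * R + v * (Real.exp ρ * R) := by ring
  rw [e]
  linarith

end ACROM
end

/-! ### Assembly of the error estimate -/

open ACROM MeasureTheory Set

set_option maxHeartbeats 800000 in
theorem theorem5p1 {d : ℕ} (hd : d = 2 ∨ d = 3) (Ω : Set (Pt d)) (hΩo : IsOpen Ω)
    (hΩb : Bornology.IsBounded Ω) (ν₀ c₁ c₂ K : ℝ) (hν₀ : 0 < ν₀) (hc₁ : 0 < c₁) :
    ∃ C : ℝ, 0 < C ∧ ∃ Ct : ℝ, 0 < Ct ∧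
      ∀ (ν T ε Δt : ℝ) (N : ℕ), 0 < ν → ν ≤ ν₀ → 0 < T → 0 < N → Δt = T / N →
      c₁ * Δt ≤ ε → ε ≤ c₂ * Δt →
      -- the exact solution
      ∀ (f : ℝ → L2V Ω) (u₀ : X Ω) (u ut : ℝ → X Ω) (utt : ℝ → L2V Ω) (p pt : ℝ → L2S Ω),
      IsWeakNSE Ω ν T f u₀ u ut p → IsTimeRegular Ω T f u ut utt p pt →
      (∀ t ∈ Icc 0 T, ‖grad (u t)‖ ≤ K) →
      -- the POD bases and the reduced order solution
      ∀ (kV kP R M : ℕ) (sV : Fin kV → X Ω) (sP : Fin kP → L2S Ω)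
        (φ : Fin R → X Ω) (ψ : Fin M → L2S Ω),
      (∀ n, MeanZero (sP n)) → IsVelPOD sV φ → IsPresPOD sP ψ →
      ∀ (uR : ℕ → X Ω) (pM : ℕ → L2S Ω),
      IsACROM (Submodule.span ℝ (range φ)) (Submodule.span ℝ (range ψ)) ν ε Δt N
        (fun n => f (n * Δt)) uR pM →
      ‖vel (uR 0)‖ ^ 2 + ν * Δt * ‖grad (uR 0)‖ ^ 2 + ε * ‖pM 0‖ ^ 2
        + 4 * Δt / ν * ∑ n ∈ Finset.range N, negNorm (f ((n + 1 : ℕ) * Δt)) ^ 2 ≤ K →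
      -- projection errors, discrete errors, total errors
      ∀ (η ξ eu : ℕ → X Ω) (κ π ep : ℕ → L2S Ω),
      (∀ n, η n = u (n * Δt) - velProj φ (u (n * Δt))) →
      (∀ n, ξ n = uR n - velProj φ (u (n * Δt))) →
      (∀ n, eu n = u (n * Δt) - uR n) →
      (∀ n, κ n = p (n * Δt) - presProj ψ (p (n * Δt))) →
      (∀ n, π n = pM n - presProj ψ (p (n * Δt))) →
      (∀ n, ep n = p (n * Δt) - pM n) →
      errEnergy ν ε Δt N eu ep ≤ errEnergy ν ε Δt N η κ
        + C * Real.exp (Ct * T / ν ^ 3) *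
          (‖vel (ξ 0)‖ ^ 2 + ε * ‖π 0‖ ^ 2 + Δt * ν * ‖grad (ξ 0)‖ ^ 2
            + (1 / ν + angleCos φ ψ ^ 2 * Δt⁻¹) * discL2sq Δt N (fun n => grad (η n))
            + 1 / ν * discL2sq Δt N κ
            + Δt ^ 2 / ν * (∫ t in (0 : ℝ)..T, ‖utt t‖ ^ 2)
            + Δt ^ 2 / ν * (∫ t in (0 : ℝ)..T, ‖grad (ut t)‖ ^ 2)
            + Δt ^ (1 / 2 : ℝ) / ν ^ (3 / 2 : ℝ)
                * (∑ n ∈ Finset.range N, ‖grad (η (n + 1))‖ ^ 4) ^ (1 / 2 : ℝ)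
            + Δt ^ 3 * (∫ t in (0 : ℝ)..T, ‖pt t‖ ^ 2)
            + Δt * (eLpNorm pt ⊤ (volume.restrict (Ioc 0 T))).toReal ^ 2) := by
  obtain ⟨L, hL⟩ := exists_triBound (Ω := Ω) hd hΩb
  have hL0 := hL.nonneg
  obtain ⟨m, hm, hdivg⟩ : ∃ m : ℝ, 0 ≤ m ∧ ∀ v : X Ω, ‖divg v‖ ≤ m * ‖grad v‖ :=
    ⟨_, norm_nonneg _, norm_divg_le⟩
  obtain ⟨A, hA⟩ : ∃ A : ℝ, A = 8 * L ^ 2 + 8 * ν₀ ^ 2 + 8 * m ^ 2 + 8 * L ^ 3 * |K| ^ 2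
      + 8 * L ^ 2 * |K| + 4 / c₁ * ν₀ * m ^ 2 + 9 * |c₂| := ⟨_, rfl⟩
  have hA0 : 0 ≤ A := by rw [hA]; positivity
  refine ⟨2 * (A + 1) + 1 + ν₀ ^ 2, by positivity,
    32 * L ^ 4 * |K| ^ 4 + (1 / c₁ + 1 + 1) * ν₀ ^ 3, by positivity, ?_⟩
  intro ν T ε Δt N hν hνν hT hN hΔ hε1 hε2 f u₀ u ut utt p pt hNS hreg hKu kV kP R M sV sP φ ψ
    _ hφ hψ uR pM hrom hKdata η ξ eu κ π ep hη hξ heu hκ hπ hep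
  replace hφ := hφ.1
  replace hψ := hψ.1
  have hNr : (0 : ℝ) < N := by exact_mod_cast hN
  have hD : 0 < Δt := by rw [hΔ]; positivity
  have hDN : Δt * N = T := by rw [hΔ]; field_simp
  have hDT : Δt ≤ T := by
    rw [← hDN]
    exact le_mul_of_one_le_right hD.le (by exact_mod_cast hN)
  have hε0 : 0 < ε := (mul_pos hc₁ hD).trans_le hε1
  have htime : ∀ n ≤ N, (n * Δt : ℝ) ∈ Icc 0 T := fun n hn => by
    refine ⟨by positivity, ?_⟩
    rw [← hDN, mul_comm Δt]
    gcongr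
  have hstep : ∀ n : ℕ, ((n + 1 : ℕ) : ℝ) * Δt - n * Δt = Δt := fun n => by push_cast; ring
  have hlt : ∀ n : ℕ, (n : ℝ) * Δt < (n + 1 : ℕ) * Δt := fun n => by linarith [hstep n]
  obtain ⟨a₀, ha₀⟩ := hreg.ut_eq
  have hdiv : ∀ n ≤ N, divg (u (n * Δt)) = 0 := fun n hn =>
    hNS.divg_eq_zero hreg hΩo hΩb hT (htime n hn)
  have hξmem : ∀ n ≤ N, ξ n ∈ Submodule.span ℝ (range φ) := fun n hn => by
    rw [hξ]; exact Submodule.sub_mem _ (hrom.mem_XR n hn) (velProj_mem _ _)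
  have hπmem : ∀ n ≤ N, π n ∈ Submodule.span ℝ (range ψ) := fun n hn => by
    rw [hπ]; exact Submodule.sub_mem _ (hrom.mem_QM n hn) (presProj_mem _ _)
  -- Two independent time indices, because the orthogonality of increments pairs different times.
  have hηo : ∀ n k, k ≤ N → inner ℝ (vel (η n)) (vel (ξ k)) = 0 := fun n k hk => by
    rw [hη]; exact velProj_orthogonal hφ _ _ (hξmem k hk)
  have hκo : ∀ n k, k ≤ N → inner ℝ (κ n) (π k) = 0 := fun n k hk => by
    rw [hκ]; exact presProj_orthogonal hψ _ _ (hπmem k hk)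
  obtain ⟨hstab1, hstab2⟩ := hrom.stability hL hν hε0 hD (hKdata.trans (le_abs_self K))
  set P := (eLpNorm pt ⊤ (volume.restrict (Ioc 0 T))).toReal with hPdef
  set α := angleCos φ ψ with hα
  let τ : ℕ → L2V Ω := fun n => Δt⁻¹ • (vel (u ((n + 1 : ℕ) * Δt)) - vel (u (n * Δt)))
    - (a₀ + ∫ s in (0 : ℝ)..((n + 1 : ℕ) * Δt), utt s)
  -- The gradient term in `S` lets the old level pay for the lagged convection term.
  let S : ℕ → ℝ := fun n => ‖vel (ξ n)‖ ^ 2 + ε * ‖π n‖ ^ 2 + ν * Δt / 2 * ‖grad (ξ n)‖ ^ 2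
  let Dd : ℕ → ℝ := fun n => ‖vel (ξ (n + 1)) - vel (ξ n)‖ ^ 2
    + ε / 2 * ‖π (n + 1) - π n‖ ^ 2 + ν * Δt / 2 * ‖grad (ξ (n + 1))‖ ^ 2
  let F : ℕ → ℝ := fun n => stepForcing L |K| m α ν ε Δt c₁ P ‖τ n‖ ‖grad (η n)‖
    ‖grad (η (n + 1))‖ ‖κ (n + 1)‖ ‖grad (u ((n + 1 : ℕ) * Δt) - u (n * Δt))‖
    (‖vel (uR n)‖ * ‖grad (uR n)‖)
  have hrec : ∀ n < N, S (n + 1) + Dd n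
      ≤ (1 + Δt * (32 * L ^ 4 * |K| ^ 4 / ν ^ 3 + 1 / c₁ + 1)) * S n + F n := by
    intro n hn
    have hid := error_identity (ν := ν) (ε := ε) (D := Δt) (u := u (n * Δt))
      (u' := u ((n + 1 : ℕ) * Δt)) (uR := uR n) (uR' := uR (n + 1)) (ξ := ξ n) (ξ' := ξ (n + 1))
      (η := η n) (η' := η (n + 1)) (p := p (n * Δt)) (p' := p ((n + 1 : ℕ) * Δt))
      (pM := pM n) (pM' := pM (n + 1)) (π := π n) (π' := π (n + 1)) (κ := κ n) (κ' := κ (n + 1))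
      (w := a₀ + ∫ s in (0 : ℝ)..((n + 1 : ℕ) * Δt), utt s) (g := f ((n + 1 : ℕ) * Δt))
      hL hD.ne' (by rw [hξ, hη]; abel) (by rw [hξ, hη]; abel) (by rw [hπ, hκ]; abel)
      (by rw [hπ, hκ]; abel)
      (by
        have h := hNS.momentum_at hL hreg hT ha₀ (htime (n + 1) hn) (ξ (n + 1))
        rwa [hL.conv_eq_skewForm hΩo hΩb (hdiv (n + 1) hn)] at h)
      (hrom.velocity n hn _ (hξmem (n + 1) hn)) (hrom.pressure n hn _ (hπmem (n + 1) hn))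
      (hdiv (n + 1) hn) (hηo _ _ hn) (hηo _ _ hn) (hκo _ _ hn) (hκo _ _ hn)
    refine error_step hL hν hD hc₁ hε1 hm hdivg
      ((hKu _ (htime (n + 1) hn)).trans (le_abs_self K)) (P := P) (α := α) ?_ ?_ hid
    · have h := norm_sub_le_of_primitive hreg.p_eq hreg.pt_mem (htime n hn.le).1 (hlt n).le
        (htime (n + 1) hn).2
      rwa [hstep] at h
    · rw [hη (n + 1)]
      exact abs_inner_divg_le_angleCos φ ψ (hdiv (n + 1) hn) (hπmem (n + 1) hn)
  have hF0 : ∀ n, 0 ≤ F n := fun n => by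
    simp only [F, stepForcing]
    positivity
  have hDd0 : ∀ n, 0 ≤ Dd n := fun n => by
    simp only [Dd]
    positivity
  have hgron := discrete_gronwall (S := S) (D := Dd) (F := F) (N := N)
    (a := Δt * (32 * L ^ 4 * |K| ^ 4 / ν ^ 3 + 1 / c₁ + 1)) (by positivity)
    (by simp only [S]; positivity) hDd0 hF0 hrec
  have hI2 : ∀ a b, 0 ≤ a → a ≤ b → b ≤ T →
      IntervalIntegrable (fun s => ‖utt s‖ ^ 2) volume a b := fun a b ha hab hb =>
    intervalIntegrable_norm_sq hreg.utt_mem ha hab hb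
  have hJ2 : ∀ a b, 0 ≤ a → a ≤ b → b ≤ T →
      IntervalIntegrable (fun s => ‖grad (ut s)‖ ^ 2) volume a b := fun a b ha hab hb =>
    intervalIntegrable_norm_sq (grad.comp_memLp' hreg.ut_mem) ha hab hb
  have hτ : ∑ n ∈ Finset.range N, ‖τ n‖ ^ 2 ≤ Δt * ∫ t in (0 : ℝ)..T, ‖utt t‖ ^ 2 := by
    rw [← sum_intervals hDN hD.le hI2, Finset.mul_sum]
    refine Finset.sum_le_sum fun n hn => ?_
    have hn' := Finset.mem_range.mp hn
    have h := hreg.sq_norm_truncation_le ha₀ (htime n hn'.le).1 (hlt n) (htime (n + 1) hn').2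
    rwa [hstep] at h
  have hδ : ∑ n ∈ Finset.range N, ‖grad (u ((n + 1 : ℕ) * Δt) - u (n * Δt))‖ ^ 2
      ≤ Δt * ∫ t in (0 : ℝ)..T, ‖grad (ut t)‖ ^ 2 := by
    rw [← sum_intervals hDN hD.le hJ2, Finset.mul_sum]
    refine Finset.sum_le_sum fun n hn => ?_
    have hn' := Finset.mem_range.mp hn
    have h := hreg.sq_norm_grad_sub_le (htime n hn'.le).1 (hlt n).le (htime (n + 1) hn').2
    rwa [hstep] at h
  have hFsum := sum_stepForcing_le (m := m) (α := α) (ε := ε) (P := P) (c₁ := c₁)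
    (h := fun n => ‖grad (η n)‖) (k := fun n => ‖κ n‖) hL0 hν hD hc₁ (abs_nonneg K) hτ hδ
    (fun n => norm_nonneg (grad (uR n)))
    (fun n hn => hstab1 n hn.le) hstab2
  have hI0 : 0 ≤ ∫ t in (0 : ℝ)..T, ‖utt t‖ ^ 2 :=
    intervalIntegral.integral_nonneg hT.le fun _ _ => sq_nonneg _
  have hJ0 : 0 ≤ ∫ t in (0 : ℝ)..T, ‖grad (ut t)‖ ^ 2 :=
    intervalIntegral.integral_nonneg hT.le fun _ _ => sq_nonneg _
  have hP0 : 0 ≤ ∫ t in (0 : ℝ)..T, ‖pt t‖ ^ 2 :=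
    intervalIntegral.integral_nonneg hT.le fun _ _ => sq_nonneg _
  have hG0 : 0 ≤ Δt * ∑ n ∈ Finset.range (N + 1), ‖grad (η n)‖ ^ 2 :=
    mul_nonneg hD.le (Finset.sum_nonneg fun _ _ => sq_nonneg _)
  have hK0 : 0 ≤ Δt * ∑ n ∈ Finset.range (N + 1), ‖κ n‖ ^ 2 :=
    mul_nonneg hD.le (Finset.sum_nonneg fun _ _ => sq_nonneg _)
  have hQ0 : 0 ≤ Δt ^ (1 / 2 : ℝ) / ν ^ (3 / 2 : ℝ)
      * (∑ n ∈ Finset.range N, ‖grad (η (n + 1))‖ ^ 4) ^ (1 / 2 : ℝ) := by positivity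
  have hdata := data_absorb (P := P) (α := α) hL0 hν hνν hD hDT hDN hc₁ hε0.le
    (hε2.trans (mul_le_mul_of_nonneg_right (le_abs_self c₂) hD.le)) (abs_nonneg K)
    (Real.cos_sq_le_one _) hI0 hJ0 hG0 hK0 hQ0 hA
  have hsplit := errEnergy_le (ε := ε) hν.le hε0.le hD.le (N := N) (η := η) (ξ := ξ) (e := eu)
    (κ := κ) (π := π) (r := ep) (fun n => by rw [heu, hη, hξ]; abel)
    (fun n => by rw [hep, hκ, hπ]; abel) (hηo _ _ le_rfl) (hκo _ _ le_rfl)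
    (fun n hn => by
      rw [inner_sub_left, inner_sub_right, inner_sub_right, hηo _ _ hn, hηo _ _ hn.le,
        hηo _ _ hn, hηo _ _ hn.le]; simp)
    (fun n hn => by
      rw [inner_sub_left, inner_sub_right, inner_sub_right, hκo _ _ hn, hκo _ _ hn.le,
        hκo _ _ hn, hκo _ _ hn.le]; simp)
  have hrate := exp_rate_le (a := 32 * L ^ 4 * |K| ^ 4) (c := 1 / c₁ + 1) hν hνν (by positivity)
    hT.le
  have hr₃ : 0 ≤ Δt * ν * ‖grad (ξ 0)‖ ^ 2 := by positivity
  have hmix : 0 ≤ α ^ 2 * Δt⁻¹ * (Δt * ∑ n ∈ Finset.range (N + 1), ‖grad (η n)‖ ^ 2) :=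
    mul_nonneg (by positivity) hG0
  -- This hides the extra `ν |||∇η|||²` of the splitting in the data term `1/ν |||∇η|||²`.
  have hnu : ν ≤ ν₀ ^ 2 * (1 / ν) := by
    rw [mul_one_div, le_div_iff₀ hν, sq]
    gcongr
  have w1 : 0 ≤ 1 / ν * (Δt * ∑ n ∈ Finset.range (N + 1), ‖κ n‖ ^ 2) :=
    mul_nonneg (by positivity) hK0
  have w2 : 0 ≤ Δt ^ 2 / ν * ∫ t in (0 : ℝ)..T, ‖utt t‖ ^ 2 := mul_nonneg (by positivity) hI0
  have w3 : 0 ≤ Δt ^ 2 / ν * ∫ t in (0 : ℝ)..T, ‖grad (ut t)‖ ^ 2 :=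
    mul_nonneg (by positivity) hJ0
  have w4 : 0 ≤ Δt * P ^ 2 := by positivity
  have w5 : 0 ≤ 1 / ν * (Δt * ∑ n ∈ Finset.range (N + 1), ‖grad (η n)‖ ^ 2) :=
    mul_nonneg (by positivity) hG0
  -- The estimate already closes with the `L^∞` norm of `p_t`; for this term only its sign matters.
  have w6 : 0 ≤ Δt ^ 3 * ∫ t in (0 : ℝ)..T, ‖pt t‖ ^ 2 := mul_nonneg (by positivity) hP0
  have hV : ν * discL2sq Δt N (fun n => grad (η n))
      ≤ ν₀ ^ 2 * (1 / ν * (Δt * ∑ n ∈ Finset.range (N + 1), ‖grad (η n)‖ ^ 2)) := by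
    rw [discL2sq, ← mul_assoc (ν₀ ^ 2)]
    exact mul_le_mul_of_nonneg_right hnu hG0
  refine conclude_from_gronwall hA0 (sq_nonneg ν₀) (W := _) ?_ (sq_nonneg ‖vel (ξ 0)‖)
    (mul_nonneg hε0.le (sq_nonneg ‖π 0‖)) hr₃ ?_ hT.le hsplit hgron (hFsum.trans hdata) ?_
    (le_trans (le_of_eq ?_) hrate) ?_ ?_
  · rw [add_mul]
    linarith
  · positivity
  · simp only [S]
    linarith
  · rw [← hDN]; ring
  · refine hV.trans (mul_le_mul_of_nonneg_left ?_ (sq_nonneg ν₀))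
    rw [add_mul]
    linarith
  · simp only [discL2sq]
    linarith
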